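/- Let $T>0$ and $\rho\ge 0$. There exist constants $c,C>0$, depending only on $T$ and $\rho$, such that the following holds for every integer $n\ge 2$ and every real $n\times n$ matrix $\xi$ with nonnegative entries, zero diagonal and $\|\xi\|_{\mathrm{op}}=\rho$, where $\|\cdot\|_{\mathrm{op}}$ is the operator norm on Euclidean space $\mathbb{R}^n$. Define $$D_T(\xi):=\sum_{i=1}^n\bigg(\sum_{m=2}^\infty\frac{T^m}{(m+1)!}(\xi^m)_{ii}\bigg)^2 .$$ (1) Suppose that $2\rho T\le\log 2$ (that is, $T\le \log(2)/(2\rho)$, with no restriction when $\rho=0$). Let $X=(X^1,\dots,X^n)$ be any weak solution of $$dX^i_t=\sum_{j=1}^n\xi_{ij}X^j_t\,dt+dB^i_t,\qquad X^i_0=0,\quad i=1,\dots,n,$$ and let $Y=(Y^1,\dots,Y^n)$ be any weak solution of the independent projection $$dY^i_t=\sum_{j=1}^n\xi_{ij}\mathbb{E}[Y^j_t]\,dt+dB^i_t,\qquad Y^i_0=0,\quad i=1,\dots,n,$$ where, in each system, $B^1,\dots,B^n$ are independent one-dimensional Brownian motions. For $v\subset\{1,\dots,n\}$ let $P^v_T$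 and $Q^v_T$ be the laws of $(X^i_T)_{i\in v}$ and $(Y^i_T)_{i\in v}$, let $H(\cdot\,|\,\cdot)$ denote relative entropy, and for $1\le k\le n$ put $$\overline H^k_T:=\binom nk^{-1}\sum_{v\subset\{1,\dots,n\},\ |v|=k}H(P^v_T\,|\,Q^v_T).$$ Then, for every $1\le k\le n$, $c\,R_k\le\overline H^k_T\le C\,R_k$, where $$R_k:=\frac{k(k-1)}{n(n-1)}\sum_{i,j=1}^n\xi_{ij}^2+\frac{k(n-k)}{n(n-1)}\bigg(D_T(\xi)+\sum_{i=1}^n\bigg(\sum_{j=1}^n\xi_{ij}^2\bigg)^2\bigg).$$ If moreover $\xi$ is symmetric, then the same two-sided bound holds with the term $D_T(\xi)$ removed from $R_k$. (2) Without any upper bound on $T$, $$c\sum_{i=1}^n\bigg(\sum_{j=1}^n\xi_{ij}\xi_{ji}\bigg)^2\le D_T(\xi)\le C\bigg(\sum_{i=1}^n\bigg(\sum_{j=1}^n\xi_{ij}^2\bigg)^2+\sum_{i=1}^n\bigg(\sum_{j=1}^n\xi_{ji}^2\bigg)^2\bigg).$$ -/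

import Mathlib

open MeasureTheory ProbabilityTheory InformationTheory
open scoped NNReal ENNReal Nat

noncomputable section

namespace LinearGaussian

/-- The processes `X^1, …, X^n` (with values `X t ω i`) are a weak solution, started at `0`, of
`dX^i_t = β^i_t dt + dB^i_t`, where `B^1, …, B^n` are independent one-dimensional Brownian motions
and `β` is the drift process. The noise is additive with unit coefficient, so that the equation is
the pathwise identity `X^i_t = ∫_0^t β^i_s ds + B^i_t`. (It is used below only with drifts that
depend Lipschitz-continuously on `X_t` and on its mean, for which adaptedness of `X` to the
filtration of `B` is automatic.) -/
structure IsDriftedBrownian {n : ℕ} {Ω : Type*} [MeasurableSpace Ω] (P : Measure Ω)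
    (β X : ℝ≥0 → Ω → Fin n → ℝ) (B : Fin n → ℝ≥0 → Ω → ℝ) : Prop where
  brownian : ∀ i, IsBrownianReal (B i) P
  indep : iIndepFun (fun i ω t => B i t ω) P
  aemeasurable : ∀ t, AEMeasurable (X t) P
  continuous_paths : ∀ᵐ ω ∂P, Continuous fun t => X t ω
  initial : ∀ᵐ ω ∂P, X 0 ω = 0
  drift_integrable : ∀ᵐ ω ∂P, ∀ (t : ℝ≥0) (i : Fin n),
    IntervalIntegrable (fun s : ℝ => β s.toNNReal ω i) volume 0 t
  equation : ∀ᵐ ω ∂P, ∀ (t : ℝ≥0) (i : Fin n),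
    X t ω i = (∫ s in (0 : ℝ)..t, β s.toNNReal ω i) + B i t ω

/-- `X` is a weak solution of the interacting particle system
`dX^i_t = ∑_j ξ_ij X^j_t dt + dB^i_t`, `X^i_0 = 0`. -/
def IsParticleSystem {n : ℕ} (ξ : Matrix (Fin n) (Fin n) ℝ)
    {Ω : Type*} [MeasurableSpace Ω] (P : Measure Ω) (X : ℝ≥0 → Ω → Fin n → ℝ) : Prop :=
  ∃ B : Fin n → ℝ≥0 → Ω → ℝ,
    IsDriftedBrownian P (fun t ω i => ∑ j, ξ i j * X t ω j) X B

/-- `Y` is a weak solution of the independent projection (a McKean-Vlasov equation)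
`dY^i_t = ∑_j ξ_ij E[Y^j_t] dt + dB^i_t`, `Y^i_0 = 0`. -/
def IsIndependentProjection {n : ℕ} (ξ : Matrix (Fin n) (Fin n) ℝ)
    {Ω : Type*} [MeasurableSpace Ω] (P : Measure Ω) (Y : ℝ≥0 → Ω → Fin n → ℝ) : Prop :=
  (∀ t j, Integrable (fun ω => Y t ω j) P) ∧
  ∃ B : Fin n → ℝ≥0 → Ω → ℝ,
    IsDriftedBrownian P (fun t _ i => ∑ j, ξ i j * ∫ ω, Y t ω j ∂P) Y B

/-- The joint law at time `t` of the coordinates in `v`. -/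
def marginalLaw {n : ℕ} {Ω : Type*} [MeasurableSpace Ω] (P : Measure Ω)
    (X : ℝ≥0 → Ω → Fin n → ℝ) (t : ℝ≥0) (v : Finset (Fin n)) : Measure (v → ℝ) :=
  P.map fun ω (i : v) => X t ω i

/-- The average over all `v` with `|v| = k` of the relative entropies `H(P^v_t | Q^v_t)`, where
`P^v_t` and `Q^v_t` are the laws at time `t` of the coordinates in `v` of `X` and of `Y`. -/
def avgEntropy {n : ℕ} {Ω Ω' : Type*} [MeasurableSpace Ω] [MeasurableSpace Ω']
    (P : Measure Ω) (X : ℝ≥0 → Ω → Fin n → ℝ) (P' : Measure Ω') (Y : ℝ≥0 → Ω' → Fin n → ℝ)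
    (t : ℝ≥0) (k : ℕ) : ℝ≥0∞ :=
  (∑ v ∈ Finset.powersetCard k (Finset.univ : Finset (Fin n)),
    klDiv (marginalLaw P X t v) (marginalLaw P' Y t v)) / (n.choose k : ℝ≥0∞)

/-- The operator norm of `ξ` on Euclidean space (the spectral norm). -/
def opNorm {n : ℕ} (ξ : Matrix (Fin n) (Fin n) ℝ) : ℝ :=
  ‖Matrix.toEuclideanCLM (𝕜 := ℝ) ξ‖

/-- `D_T(ξ) = ∑_i (∑_{m ≥ 2} T^m / (m+1)! * (ξ^m)_ii)^2`; the inner series, which converges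
absolutely, is indexed by `m - 2`. -/
def D {n : ℕ} (T : ℝ) (ξ : Matrix (Fin n) (Fin n) ℝ) : ℝ :=
  ∑ i, (∑' m : ℕ, T ^ (m + 2) / ((m + 3)! : ℝ) * (ξ ^ (m + 2)) i i) ^ 2

/-- `∑_i (∑_j ξ_ij^2)^2`. -/
def rowQuartic {n : ℕ} (ξ : Matrix (Fin n) (Fin n) ℝ) : ℝ :=
  ∑ i, (∑ j, ξ i j ^ 2) ^ 2

/-- `k(k-1)/(n(n-1)) * ∑_ij ξ_ij^2 + k(n-k)/(n(n-1)) * R`. -/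
def profile {n : ℕ} (k : ℕ) (ξ : Matrix (Fin n) (Fin n) ℝ) (R : ℝ) : ℝ :=
  (k * (k - 1) : ℝ) / (n * (n - 1)) * ∑ i, ∑ j, ξ i j ^ 2 +
    (k * (n - k) : ℝ) / (n * (n - 1)) * R

end LinearGaussian

end

/-!
The system is linear with additive noise and starts at `0`, so `X_T` is a centred Gaussian vector
with covariance matrix `∫_0^T exp (s ξ) exp (s ξ)ᵀ ds` (`IsParticleSystem.isCenteredGaussian`). This
is obtained pathwise: variation of constants (`dotProduct_eq_of_integral_equation`) expresses a linear
functional of `X_T` through Riemann–Stieltjes integrals of `C¹` functions against Brownian paths, and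
the characteristic function of such integrals is the limit of those of step approximations
(`integral_exp_wiener`). The mean of `Y` solves a linear equation with zero data, hence vanishes, so
that `Y_T` has the law `N(0, T · 1)`.

Write the covariance matrix of `X_T` as `T (1 + M)`, with `M = relCov ξ T`. The relative entropy of
`N(0, T (1 + M_v))` with respect to `N(0, T · 1)`, where `M_v` is the principal submatrix on `v`, is
`½ ∑ (x - 1 - log x)` over the eigenvalues `x` of `1 + M_v`. These lie in
`[exp (-2 T ρ), exp (2 T ρ)]`, an interval on which `x - 1 - log x` is comparable to `(x - 1)²`.
Therefore the entropy is comparable to the squared Frobenius norm of `M_v` (`klDiv_marginalLaw`), and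
the average over `v` is a counting argument (`sum_powersetCard_sum_sum`):
`k (k - 1) / (n (n - 1)) ∑_{i,j} M_ij² + k (n - k) / (n (n - 1)) ∑_i M_ii²`.

With `F = exp (s ξ) - 1`, the matrix `M` is the average over `s ∈ [0, T]` of `F + Fᵀ + F Fᵀ`. As `ξ`
has nonnegative entries, `F ≥ s ξ` entrywise, and `F = ξ G` with a bounded matrix `G`. This makes
`∑ M_ij²` comparable to `∑ ξ_ij²`. On the diagonal, `M_ii` is twice the inner series of `D_T(ξ)` plus
the average of `∑_l F_il²` (`relCov_diag`); both terms are nonnegative and the latter is comparable to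
`∑_j ξ_ij²`, so that `∑ M_ii²` is comparable to `D_T(ξ) + ∑_i (∑_j ξ_ij²)²`.

Finally, the first term of the inner series of `D_T(ξ)` gives its lower bound, and the Cauchy–Schwarz
inequality applied to row `i`, column `i` and `ξ^m` gives the upper one. For symmetric `ξ`, rows and
columns coincide, and `D_T(ξ)` is dominated by `∑_i (∑_j ξ_ij²)²`.
-/


/-! ### Relative entropy of product Gaussian laws -/

namespace LinearGaussian

/-- A product of measures with densities has the product density. -/
lemma pi_withDensity {ι : Type*} [Fintype ι] (ν : ι → Measure ℝ) [∀ i, IsProbabilityMeasure (ν i)]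
    (f : ι → ℝ → ℝ≥0∞) (hf : ∀ i, Measurable (f i))
    [∀ i, SigmaFinite ((ν i).withDensity (f i))] :
    Measure.pi (fun i => (ν i).withDensity (f i)) =
      (Measure.pi ν).withDensity (fun x => ∏ i, f i (x i)) := by
  refine (Measure.pi_eq fun s hs => ?_)
  have hind : iIndepFun (fun i (x : ι → ℝ) => (s i).indicator (f i) (x i)) (Measure.pi ν) :=
    iIndepFun_pi fun i => ((hf i).indicator (hs i)).aemeasurable
  rw [withDensity_apply _ (MeasurableSet.univ_pi hs), ← lintegral_indicator (MeasurableSet.univ_pi hs)]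
  have h1 : ∀ x : ι → ℝ, (Set.univ.pi s).indicator (fun x => ∏ i, f i (x i)) x =
      ∏ i, (s i).indicator (f i) (x i) := by
    intro x
    by_cases hx : x ∈ Set.univ.pi s
    · rw [Set.indicator_of_mem hx]
      refine Finset.prod_congr rfl fun i _ => ?_
      rw [Set.indicator_of_mem (hx i (Set.mem_univ i))]
    · rw [Set.indicator_of_notMem hx]
      obtain ⟨i, hi⟩ : ∃ i, x i ∉ s i := by simpa [Set.mem_pi] using hx
      exact (Finset.prod_eq_zero (Finset.mem_univ i) (Set.indicator_of_notMem hi _)).symm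
  simp_rw [h1]
  rw [lintegral_prod_eq_prod_lintegral_of_indepFun _ _ hind
    (fun i => ((hf i).indicator (hs i)).comp (measurable_pi_apply i))]
  refine Finset.prod_congr rfl fun i _ => ?_
  rw [withDensity_apply _ (hs i), ← lintegral_indicator (hs i),
    ← (measurePreserving_eval ν i).lintegral_comp ((hf i).indicator (hs i))]

/-- The density of `N(0, a)` with respect to `N(0, b)`. -/
noncomputable def gaussianRatio (a b : ℝ≥0) (x : ℝ) : ℝ :=
  √(b / a) * Real.exp (x ^ 2 / (2 * b) - x ^ 2 / (2 * a))

lemma measurable_gaussianRatio (a b : ℝ≥0) : Measurable (gaussianRatio a b) := by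
  unfold gaussianRatio; fun_prop

lemma gaussianRatio_pos {a b : ℝ≥0} (ha : a ≠ 0) (hb : b ≠ 0) (x : ℝ) : 0 < gaussianRatio a b x := by
  have := NNReal.coe_pos.2 (pos_iff_ne_zero.2 ha)
  have := NNReal.coe_pos.2 (pos_iff_ne_zero.2 hb)
  unfold gaussianRatio; positivity

lemma gaussianReal_eq_withDensity {a b : ℝ≥0} (ha : a ≠ 0) (hb : b ≠ 0) :
    gaussianReal 0 a =
      (gaussianReal 0 b).withDensity (fun x => ENNReal.ofReal (gaussianRatio a b x)) := by
  have ha' := NNReal.coe_pos.2 (pos_iff_ne_zero.2 ha)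
  have hb' := NNReal.coe_pos.2 (pos_iff_ne_zero.2 hb)
  rw [gaussianReal_of_var_ne_zero _ ha, gaussianReal_of_var_ne_zero _ hb,
    ← withDensity_mul _ (measurable_gaussianPDF _ _) (measurable_gaussianRatio a b).ennreal_ofReal]
  congr 1
  ext x
  simp only [gaussianPDF, Pi.mul_apply]
  rw [← ENNReal.ofReal_mul (gaussianPDFReal_nonneg _ _ _)]
  congr 1
  simp only [gaussianPDFReal, gaussianRatio, sub_zero]
  have : Real.exp (-x ^ 2 / (2 * a)) = Real.exp (-x ^ 2 / (2 * b)) *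
      Real.exp (x ^ 2 / (2 * b) - x ^ 2 / (2 * a)) := by
    rw [← Real.exp_add]; congr 1; ring
  rw [this, Real.sqrt_div hb'.le, Real.sqrt_mul (by positivity) (a : ℝ),
    Real.sqrt_mul (by positivity) (b : ℝ)]
  field_simp

lemma log_gaussianRatio {a b : ℝ≥0} (ha : a ≠ 0) (hb : b ≠ 0) (x : ℝ) :
    Real.log (gaussianRatio a b x) =
      -(Real.log (a / b)) / 2 + (1 / (2 * b) - 1 / (2 * a)) * x ^ 2 := by
  have ha' := NNReal.coe_pos.2 (pos_iff_ne_zero.2 ha)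
  have hb' := NNReal.coe_pos.2 (pos_iff_ne_zero.2 hb)
  rw [gaussianRatio, Real.log_mul (by positivity) (by positivity), Real.log_exp,
    Real.log_sqrt (by positivity), Real.log_div hb'.ne' ha'.ne', Real.log_div ha'.ne' hb'.ne']
  ring

/-- The relative entropy of `⨂ N(0, a i)` with respect to `⨂ N(0, b)`. The log-likelihood ratio is a
sum of affine functions of `(x i)²`, whose means are known. -/
lemma klDiv_pi_gaussianReal {ι : Type*} [Fintype ι] {a : ι → ℝ≥0} {b : ℝ≥0} (ha : ∀ i, a i ≠ 0)
    (hb : b ≠ 0) :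
    klDiv (Measure.pi fun i => gaussianReal 0 (a i)) (Measure.pi fun _ : ι => gaussianReal 0 b) =
      ENNReal.ofReal (∑ i, ((a i / b : ℝ) - 1 - Real.log (a i / b)) / 2) := by
  have hb' := NNReal.coe_pos.2 (pos_iff_ne_zero.2 hb)
  set ν : Measure (ι → ℝ) := Measure.pi fun _ : ι => gaussianReal 0 b
  set μ : Measure (ι → ℝ) := Measure.pi fun i => gaussianReal 0 (a i) with hμ
  have hdens : μ = ν.withDensity
      (fun x => ∏ i, ENNReal.ofReal (gaussianRatio (a i) b (x i))) := by
    have (i : ι) : SigmaFinite ((gaussianReal 0 b).withDensity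
        (fun x => ENNReal.ofReal (gaussianRatio (a i) b x))) := by
      rw [← gaussianReal_eq_withDensity (ha i) hb]; infer_instance
    rw [hμ]
    simp_rw [fun i => gaussianReal_eq_withDensity (ha i) hb]
    exact pi_withDensity _ _ fun i => (measurable_gaussianRatio (a i) b).ennreal_ofReal
  have hmeas : Measurable fun x : ι → ℝ => ∏ i, ENNReal.ofReal (gaussianRatio (a i) b (x i)) :=
    Finset.measurable_prod _ fun i _ =>
      (measurable_gaussianRatio (a i) b).ennreal_ofReal.comp (measurable_pi_apply i)
  have hac : μ ≪ ν := hdens ▸ withDensity_absolutelyContinuous _ _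
  have hllr : llr μ ν =ᵐ[μ] fun x => ∑ i, (-(Real.log (a i / b)) / 2 +
      (1 / (2 * b) - 1 / (2 * a i)) * (x i) ^ 2) := by
    have h1 : μ.rnDeriv ν =ᵐ[μ] fun x => ∏ i, ENNReal.ofReal (gaussianRatio (a i) b (x i)) := by
      refine hac.ae_le ?_
      have h2 := Measure.rnDeriv_withDensity ν hmeas
      rwa [← hdens] at h2
    filter_upwards [h1] with x hx
    rw [llr, hx, ENNReal.toReal_prod, Real.log_prod]
    · refine Finset.sum_congr rfl fun i _ => ?_
      rw [ENNReal.toReal_ofReal (gaussianRatio_pos (ha i) hb _).le, log_gaussianRatio (ha i) hb]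
    · intro i _
      rw [ENNReal.toReal_ofReal (gaussianRatio_pos (ha i) hb _).le]
      exact (gaussianRatio_pos (ha i) hb _).ne'
  have hsq (i : ι) : Integrable (fun x : ℝ => x ^ 2) (gaussianReal 0 (a i)) :=
    (memLp_id_gaussianReal 2).integrable_sq
  have hsqv (i : ι) : ∫ x, x ^ 2 ∂(gaussianReal 0 (a i)) = a i := by
    have := variance_fun_id_gaussianReal (μ := 0) (v := a i)
    rwa [variance_of_integral_eq_zero (by fun_prop) (by simp)] at this
  have hint (i : ι) : Integrable (fun x : ℝ => -(Real.log (a i / b)) / 2 +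
      (1 / (2 * b) - 1 / (2 * a i)) * x ^ 2) (gaussianReal 0 (a i)) :=
    (integrable_const _).add ((hsq i).const_mul _)
  have hint' (i : ι) : Integrable (fun x : ι → ℝ => -(Real.log (a i / b)) / 2 +
      (1 / (2 * b) - 1 / (2 * a i)) * (x i) ^ 2) μ :=
    integrable_comp_eval (μ := fun i => gaussianReal 0 (a i)) (hint i)
  rw [klDiv_of_ac_of_integrable hac
    ((integrable_congr hllr).2 (integrable_finsetSum _ fun i _ => hint' i)), integral_congr_ae hllr,
    integral_finsetSum _ fun i _ => hint' i]
  simp only [probReal_univ, add_sub_cancel_right]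
  congr 1
  refine Finset.sum_congr rfl fun i _ => ?_
  have ha' := NNReal.coe_pos.2 (pos_iff_ne_zero.2 (ha i))
  rw [integral_comp_eval (μ := fun i => gaussianReal 0 (a i)) (i := i)
    (f := fun x : ℝ => -(Real.log (a i / b)) / 2 + (1 / (2 * b) - 1 / (2 * a i)) * x ^ 2)
    (hint i).aestronglyMeasurable, integral_add (integrable_const _) ((hsq i).const_mul _),
    integral_const_mul, hsqv]
  simp only [integral_const, probReal_univ, smul_eq_mul]
  field_simp
  ring

lemma klDiv_map_measurableEquiv {α β : Type*} [MeasurableSpace α] [MeasurableSpace β]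
    (μ ν : Measure α) [IsFiniteMeasure μ] [IsFiniteMeasure ν] (e : α ≃ᵐ β) :
    klDiv (μ.map e) (ν.map e) = klDiv μ ν := by
  refine le_antisymm (klDiv_map_le _ _ e.measurable) ?_
  have h := klDiv_map_le (μ.map e) (ν.map e) e.symm.measurable
  simpa [Measure.map_map e.symm.measurable e.measurable] using h

/-- The lower half of the comparison of `x - 1 - log x` with `(x - 1)²` on compact subsets of
`(0, ∞)`. With `y = √x`, the bound `log y ≤ y - 1` gives `(y - 1)² ≤ x - 1 - log x`, and
`(x - 1)² = (y - 1)² (y + 1)²`. -/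
lemma sq_le_sub_one_sub_log {x b : ℝ} (hx : 0 < x) (hb : x ≤ b) :
    (x - 1) ^ 2 / (2 * (b + 1)) ≤ x - 1 - Real.log x := by
  have h1 : Real.log x = 2 * Real.log (√x) := by rw [Real.log_sqrt hx.le]; ring
  have h2 := Real.log_le_sub_one_of_pos (Real.sqrt_pos.2 hx)
  have h3 : x = √x ^ 2 := (Real.sq_sqrt hx.le).symm
  set y := √x
  have hy : 0 < y := Real.sqrt_pos.2 hx
  rw [h1, div_le_iff₀ (by linarith)]
  have h4 : (x - 1) ^ 2 = (y - 1) ^ 2 * (y + 1) ^ 2 := by rw [h3]; ring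
  have h5 : (y + 1) ^ 2 ≤ 2 * (b + 1) := by nlinarith [sq_nonneg (y - 1)]
  have h6 : (y - 1) ^ 2 ≤ x - 1 - 2 * Real.log y := by rw [h3]; linarith
  rw [h4]
  exact mul_le_mul h6 h5 (by positivity) ((sq_nonneg _).trans h6)

lemma sub_one_sub_log_le_sq {x a : ℝ} (ha : 0 < a) (hx : a ≤ x) :
    x - 1 - Real.log x ≤ (x - 1) ^ 2 / a := by
  have hx0 : 0 < x := ha.trans_le hx
  have h := Real.one_sub_inv_le_log_of_pos hx0
  calc x - 1 - Real.log x ≤ x - 1 - (1 - x⁻¹) := by linarith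
    _ = (x - 1) ^ 2 / x := by field_simp
    _ ≤ (x - 1) ^ 2 / a := by gcongr

end LinearGaussian

/-! ### Relative entropy of centred Gaussian vectors -/

namespace LinearGaussian
open Matrix

/-- `μ` is the centred Gaussian law with covariance matrix `S`, expressed through its
characteristic function. -/
def IsCenteredGaussian {ι : Type*} [Fintype ι] (μ : Measure (ι → ℝ)) (S : Matrix ι ι ℝ) : Prop :=
  ∀ u : ι → ℝ, ∫ x, Complex.exp ((u ⬝ᵥ x : ℝ) * Complex.I) ∂μ =
    Complex.exp (-((u ⬝ᵥ S *ᵥ u : ℝ) : ℂ) / 2)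

section Diagonalization

variable {ι : Type*} [Fintype ι]

lemma dotProduct_conj_mulVec (U S : Matrix ι ι ℝ) (t : ι → ℝ) :
    t ⬝ᵥ (Uᵀ * S * U) *ᵥ t = (U *ᵥ t) ⬝ᵥ S *ᵥ (U *ᵥ t) := by
  rw [← mulVec_mulVec, ← mulVec_mulVec, dotProduct_mulVec, vecMul_transpose]

variable [DecidableEq ι]

/-- An orthogonal change of variables which diagonalizes the covariance matrix turns a centred
Gaussian law into a product of one-dimensional ones. -/
lemma IsCenteredGaussian.map_orthogonal {μ : Measure (ι → ℝ)} [IsProbabilityMeasure μ]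
    {S U : Matrix ι ι ℝ} (hμ : IsCenteredGaussian μ S) {a : ι → ℝ≥0}
    (hU : Uᵀ * S * U = diagonal fun i => (a i : ℝ)) :
    μ.map (fun x => Uᵀ *ᵥ x) = Measure.pi fun i => gaussianReal 0 (a i) := by
  have hm : Measurable fun x : ι → ℝ => Uᵀ *ᵥ x := by
    have : Continuous fun x : ι → ℝ => Uᵀ *ᵥ x := by fun_prop
    exact this.measurable
  have : IsProbabilityMeasure (μ.map (fun x => Uᵀ *ᵥ x)) :=
    Measure.isProbabilityMeasure_map hm.aemeasurable
  refine charFun_eq_pi_iff.1 fun t => ?_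
  have h1 : charFun ((μ.map (fun x => Uᵀ *ᵥ x)).map (WithLp.toLp 2)) t =
      ∫ x, Complex.exp (((U *ᵥ t.ofLp) ⬝ᵥ x : ℝ) * Complex.I) ∂μ := by
    rw [Measure.map_map (by fun_prop) hm, charFun_apply,
      integral_map ((by fun_prop : Measurable (WithLp.toLp 2)).comp hm).aemeasurable (by fun_prop)]
    refine integral_congr_ae (Filter.Eventually.of_forall fun x => ?_)
    simp only [Function.comp_apply, EuclideanSpace.inner_eq_star_dotProduct, star_trivial]
    rw [dotProduct_mulVec, vecMul_transpose]
  rw [h1, hμ, ← dotProduct_conj_mulVec, hU]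
  simp_rw [charFun_gaussianReal]
  rw [← Complex.exp_sum]
  congr 1
  simp only [mulVec_diagonal, dotProduct]
  push_cast
  rw [← Finset.sum_neg_distrib, Finset.sum_div]
  refine Finset.sum_congr rfl fun i _ => ?_
  simp
  ring

/-- The relative entropy of a centred Gaussian law with respect to an isotropic one is comparable
to the squared Frobenius distance of the normalized covariance matrix from the identity: it is
`½ ∑ (x - 1 - log x)` over the eigenvalues `x` of the normalized covariance matrix, all of which lie
in `[α, β]`. -/
lemma klDiv_isCenteredGaussian {μ ν : Measure (ι → ℝ)} [IsProbabilityMeasure μ]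
    [IsProbabilityMeasure ν] {M : Matrix ι ι ℝ} (hM : M.IsHermitian) {b : ℝ≥0} (hb : b ≠ 0)
    (hμ : IsCenteredGaussian μ ((b : ℝ) • (1 + M))) (hν : IsCenteredGaussian ν ((b : ℝ) • 1))
    {α β : ℝ} (hα : 0 < α) (hlow : ∀ u : ι → ℝ, α * (u ⬝ᵥ u) ≤ u ⬝ᵥ (1 + M) *ᵥ u)
    (hup : ∀ u : ι → ℝ, u ⬝ᵥ (1 + M) *ᵥ u ≤ β * (u ⬝ᵥ u)) :
    ∃ h : ℝ, klDiv μ ν = ENNReal.ofReal h ∧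
      (∑ i, ∑ j, M i j ^ 2) / (4 * (β + 1)) ≤ h ∧ h ≤ (∑ i, ∑ j, M i j ^ 2) / (2 * α) := by
  set U : Matrix ι ι ℝ := hM.eigenvectorUnitary.1
  set d := hM.eigenvalues
  have hUU : Uᵀ * U = 1 := by
    have := Unitary.coe_star_mul_self hM.eigenvectorUnitary
    rwa [star_eq_conjTranspose, conjTranspose_eq_transpose_of_trivial] at this
  have hUU' : U * Uᵀ = 1 := mul_eq_one_comm.1 hUU
  have hspec : M = U * diagonal d * Uᵀ := by
    have := hM.spectral_theorem
    rw [Unitary.conjStarAlgAut_apply, star_eq_conjTranspose,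
      conjTranspose_eq_transpose_of_trivial] at this
    exact this
  have hdiag : Uᵀ * M * U = diagonal d := by
    rw [hspec, show Uᵀ * (U * diagonal d * Uᵀ) * U = (Uᵀ * U) * diagonal d * (Uᵀ * U) by
      simp only [Matrix.mul_assoc], hUU, Matrix.one_mul, Matrix.mul_one]
  have hdiag1 : Uᵀ * (1 + M) * U = diagonal fun i => 1 + d i := by
    rw [Matrix.mul_add, Matrix.add_mul, hdiag, Matrix.mul_one, hUU, ← diagonal_one,
      diagonal_add]
  -- the eigenvalues are values of the quadratic form at unit vectors
  have heig (i : ι) : α ≤ 1 + d i ∧ 1 + d i ≤ β := by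
    have h1 := dotProduct_conj_mulVec U (1 + M) (Pi.single i 1)
    have h2 := dotProduct_conj_mulVec U 1 (Pi.single i 1)
    rw [hdiag1] at h1
    rw [Matrix.mul_one, hUU, one_mulVec, one_mulVec] at h2
    have h3 := hlow (U *ᵥ Pi.single i 1)
    have h4 := hup (U *ᵥ Pi.single i 1)
    rw [← h1, ← h2] at h3 h4
    simp at h3 h4
    exact ⟨h3, h4⟩
  -- the squared Frobenius norm is the trace of `M²`
  have hsum : ∑ i, ∑ j, M i j ^ 2 = ∑ i, d i ^ 2 := by
    have h1 : ∑ i, ∑ j, M i j ^ 2 = (M * Mᵀ).trace := by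
      simp [trace, mul_apply, sq]
    have hMt : Mᵀ = M := by
      rw [← conjTranspose_eq_transpose_of_trivial]; exact hM
    rw [h1, hMt]
    conv_lhs => rw [hspec]
    rw [show U * diagonal d * Uᵀ * (U * diagonal d * Uᵀ) =
      U * (diagonal d * (Uᵀ * U) * diagonal d) * Uᵀ by simp only [Matrix.mul_assoc], hUU,
      Matrix.mul_one, trace_mul_comm, ← Matrix.mul_assoc, hUU, Matrix.one_mul, diagonal_mul_diagonal]
    simp [trace, sq]
  have hpos (i : ι) : 0 < 1 + d i := hα.trans_le (heig i).1
  have hb' : (0 : ℝ) < b := NNReal.coe_pos.2 (pos_iff_ne_zero.2 hb)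
  set a : ι → ℝ≥0 := fun i => b * (1 + d i).toNNReal
  have ha (i : ι) : (a i : ℝ) = b * (1 + d i) := by simp [a, Real.coe_toNNReal _ (hpos i).le]
  have ha0 (i : ι) : a i ≠ 0 := by
    rw [← NNReal.coe_ne_zero, ha]; exact (mul_pos hb' (hpos i)).ne'
  let L : (ι → ℝ) ≃ᵐ (ι → ℝ) :=
    { toFun := fun x => Uᵀ *ᵥ x
      invFun := fun x => U *ᵥ x
      left_inv := fun x => by simp [hUU']
      right_inv := fun x => by simp [hUU]
      measurable_toFun := (by fun_prop : Continuous fun x : ι → ℝ => Uᵀ *ᵥ x).measurable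
      measurable_invFun := (by fun_prop : Continuous fun x : ι → ℝ => U *ᵥ x).measurable }
  have hμL : μ.map L = Measure.pi fun i => gaussianReal 0 (a i) := by
    refine hμ.map_orthogonal ?_
    simp_rw [ha]
    rw [Matrix.mul_smul, Matrix.smul_mul, hdiag1, ← diagonal_smul]
    rfl
  have hνL : ν.map L = Measure.pi fun _ : ι => gaussianReal 0 b := by
    refine hν.map_orthogonal ?_
    rw [Matrix.mul_smul, Matrix.smul_mul, Matrix.mul_one, hUU, smul_one_eq_diagonal]
  refine ⟨∑ i, ((1 + d i) - 1 - Real.log (1 + d i)) / 2, ?_, ?_, ?_⟩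
  · rw [← klDiv_map_measurableEquiv μ ν L, hμL, hνL, klDiv_pi_gaussianReal ha0 hb]
    congr 1
    refine Finset.sum_congr rfl fun i _ => ?_
    rw [ha, mul_div_cancel_left₀ _ hb'.ne']
  · rw [hsum, Finset.sum_div]
    refine Finset.sum_le_sum fun i _ => ?_
    have := sq_le_sub_one_sub_log (hpos i) (heig i).2
    calc d i ^ 2 / (4 * (β + 1)) = (1 + d i - 1) ^ 2 / (2 * (β + 1)) / 2 := by
          rw [div_div]; congr 1 <;> ring
      _ ≤ _ := by gcongr
  · rw [hsum, Finset.sum_div]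
    refine Finset.sum_le_sum fun i _ => ?_
    have := sub_one_sub_log_le_sq hα (heig i).1
    calc _ ≤ (1 + d i - 1) ^ 2 / α / 2 := by gcongr
      _ = d i ^ 2 / (2 * α) := by rw [div_div]; congr 1 <;> ring

end Diagonalization

end LinearGaussian

/-! ### Riemann–Stieltjes sums -/

namespace LinearGaussian
open Filter Topology

/-- Riemann–Stieltjes sums of a `C¹` integrand against a continuous integrator converge, to the
expression obtained by integration by parts. The integrand is evaluated at the right endpoints, so
that summation by parts leaves `b` at the left endpoints. -/
lemma tendsto_sum_mul_increment {g g' b : ℝ → ℝ} {T : ℝ} (hT : 0 ≤ T)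
    (hg : ∀ s, HasDerivAt g (g' s) s) (hg' : Continuous g') (hb : Continuous b) :
    Tendsto (fun N : ℕ => ∑ k ∈ Finset.range N, g ((k + 1 : ℕ) * (T / N)) *
        (b ((k + 1 : ℕ) * (T / N)) - b (k * (T / N)))) atTop
      (𝓝 (g T * b T - g 0 * b 0 - ∫ s in (0 : ℝ)..T, g' s * b s)) := by
  obtain ⟨M, hM⟩ := isCompact_Icc.exists_bound_of_continuousOn (s := Set.Icc 0 T) hg'.continuousOn
  have hM0 : 0 ≤ M := (norm_nonneg _).trans (hM 0 ⟨le_rfl, hT⟩)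
  have huc := isCompact_Icc.uniformContinuousOn_of_continuous (s := Set.Icc 0 T) hb.continuousOn
  rw [Metric.uniformContinuousOn_iff] at huc
  rw [Metric.tendsto_atTop]
  intro ε hε
  obtain ⟨δ, hδ, hbδ⟩ := huc (ε / (M * T + 1)) (by positivity)
  obtain ⟨N₀, hN₀⟩ := exists_nat_gt (T / δ)
  refine ⟨N₀ + 1, fun N hN => ?_⟩
  have hNpos : (0 : ℝ) < N := by exact_mod_cast (show 0 < N by omega)
  have hstep : T / N < δ := by
    have h1 : (N₀ : ℝ) ≤ N := by exact_mod_cast (show N₀ ≤ N by omega)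
    rw [div_lt_iff₀ hNpos]
    rw [div_lt_iff₀ hδ] at hN₀
    nlinarith
  have hh : 0 ≤ T / N := by positivity
  set t : ℕ → ℝ := fun k => k * (T / N) with ht
  have htN : t N = T := by simp only [ht]; field_simp
  have ht0 : t 0 = 0 := by simp [ht]
  have hts (k : ℕ) : t (k + 1) = t k + T / N := by simp only [ht]; push_cast; ring
  have htmono (k : ℕ) : t k ≤ t (k + 1) := by rw [hts]; linarith
  have hnonneg (k : ℕ) : 0 ≤ t k := by simp only [ht]; positivity
  have hle (k : ℕ) (hk : k < N) : t (k + 1) ≤ T := by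
    have : ((k + 1 : ℕ) : ℝ) ≤ N := by exact_mod_cast hk
    calc t (k + 1) ≤ N * (T / N) := by simp only [ht]; gcongr
      _ = T := htN
  have hint : ∀ f : ℝ → ℝ, Continuous f → ∫ s in (0 : ℝ)..T, f s =
      ∑ k ∈ Finset.range N, ∫ s in t k..t (k + 1), f s := by
    intro f hf
    rw [intervalIntegral.sum_integral_adjacent_intervals fun k _ => hf.intervalIntegrable _ _, ht0, htN]
  have hdiff (k : ℕ) : g (t (k + 1)) - g (t k) = ∫ s in t k..t (k + 1), g' s :=
    (intervalIntegral.integral_eq_sub_of_hasDerivAt (fun s _ => hg s) (hg'.intervalIntegrable _ _)).symm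
  have htele : g T * b T - g 0 * b 0 =
      ∑ k ∈ Finset.range N, (g (t (k + 1)) * b (t (k + 1)) - g (t k) * b (t k)) := by
    rw [Finset.sum_range_sub (fun k => g (t k) * b (t k)), ht0, htN]
  -- the error of the sums, with the increments of `g` written as integrals of `g'` over the steps
  have herr : (∑ k ∈ Finset.range N, g (t (k + 1)) * (b (t (k + 1)) - b (t k))) -
      (g T * b T - g 0 * b 0 - ∫ s in (0 : ℝ)..T, g' s * b s) =
      ∑ k ∈ Finset.range N, ∫ s in t k..t (k + 1), g' s * (b s - b (t k)) := by
    rw [htele, hint (fun s => g' s * b s) (hg'.mul hb), ← Finset.sum_sub_distrib, ← Finset.sum_sub_distrib]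
    refine Finset.sum_congr rfl fun k _ => ?_
    have : ∫ s in t k..t (k + 1), g' s * (b s - b (t k)) =
        (∫ s in t k..t (k + 1), g' s * b s) - (g (t (k + 1)) - g (t k)) * b (t k) := by
      rw [hdiff, ← intervalIntegral.integral_mul_const, ← intervalIntegral.integral_sub
        (f := fun s => g' s * b s) (g := fun s => g' s * b (t k)) ((hg'.mul hb).intervalIntegrable _ _)
        ((hg'.mul continuous_const).intervalIntegrable _ _)]
      simp_rw [mul_sub]
    rw [this]
    ring
  rw [Real.dist_eq]
  change |(∑ k ∈ Finset.range N, g (t (k + 1)) * (b (t (k + 1)) - b (t k))) - _| < ε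
  rw [herr]
  calc |∑ k ∈ Finset.range N, ∫ s in t k..t (k + 1), g' s * (b s - b (t k))|
      ≤ ∑ k ∈ Finset.range N, M * (ε / (M * T + 1)) * (T / N) := by
        refine (Finset.abs_sum_le_sum_abs _ _).trans (Finset.sum_le_sum fun k hk => ?_)
        have hkN := hle k (Finset.mem_range.1 hk)
        have := intervalIntegral.norm_integral_le_of_norm_le_const (a := t k) (b := t (k + 1))
          (f := fun s => g' s * (b s - b (t k))) (C := M * (ε / (M * T + 1))) ?_
        · rwa [hts, add_sub_cancel_left, abs_of_nonneg hh, ← hts, Real.norm_eq_abs] at this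
        · intro s hs
          rw [Set.uIoc_of_le (htmono k)] at hs
          have hs0 : s ∈ Set.Icc 0 T := ⟨(hnonneg k).trans hs.1.le, hs.2.trans hkN⟩
          rw [norm_mul]
          gcongr
          · exact hM s hs0
          · refine (hbδ s hs0 (t k) ⟨hnonneg k, (htmono k).trans hkN⟩ ?_).le
            rw [Real.dist_eq, abs_of_nonneg (by linarith [hs.1])]
            linarith [hs.2, hts k]
    _ = M * T * ε / (M * T + 1) := by
        rw [Finset.sum_const, Finset.card_range, nsmul_eq_mul]
        field_simp
    _ < ε := by
        rw [div_lt_iff₀ (by positivity)]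
        nlinarith

end LinearGaussian

/-! ### Wiener integrals of deterministic functions -/

namespace LinearGaussian
open Filter Topology

section Wiener

variable {Ω : Type*} [MeasurableSpace Ω] {P : Measure Ω}

/-- The characteristic function of the stochastic integral of a step function. -/
lemma charFun_sum_increment {b : ℝ≥0 → Ω → ℝ} (hb : IsPreBrownianReal b P) (N : ℕ) (h : ℝ≥0)
    (a : ℕ → ℝ) (u : ℝ) :
    charFun (P.map fun ω => ∑ k ∈ Finset.range N, a k * (b ((k + 1 : ℕ) * h) ω - b (k * h) ω)) u =
      Complex.exp (-((∑ k ∈ Finset.range N, a k ^ 2 * h : ℝ) : ℂ) * u ^ 2 / 2) := by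
  have : IsProbabilityMeasure P := hb.isGaussianProcess.isProbabilityMeasure
  have hmeas (s t : ℝ≥0) : AEMeasurable (fun ω => b t ω - b s ω) P :=
    (hb.aemeasurable t).sub (hb.aemeasurable s)
  have hind : iIndepFun (fun (k : Fin N) ω =>
      a k * (b ((k + 1 : ℕ) * h) ω - b ((k : ℕ) * h) ω)) P := by
    have hmono : Monotone fun k : Fin (N + 1) => ((k : ℕ) : ℝ≥0) * h := by
      intro i j hij
      have : ((i : ℕ) : ℝ≥0) ≤ (j : ℕ) := by exact_mod_cast hij
      exact mul_le_mul_left this h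
    have h1 := hb.hasIndepIncrements N _ hmono
    exact h1.comp (fun k x => a k * x) fun k => by fun_prop
  have hone (k : ℕ) : charFun (P.map fun ω => a k * (b ((k + 1 : ℕ) * h) ω - b (k * h) ω)) u =
      Complex.exp (-((a k ^ 2 * h : ℝ) : ℂ) * u ^ 2 / 2) := by
    have hlaw := gaussianReal_const_mul (hb.hasLaw_sub ((k + 1 : ℕ) * h) (k * h)) (a k)
    have h2 : (P.map fun ω => a k * (b ((k + 1 : ℕ) * h) ω - b (k * h) ω)) = _ := hlaw.map_eq
    have h3 : nndist (((k + 1 : ℕ) * h : ℝ≥0) : ℝ) ((k * h : ℝ≥0) : ℝ) = h := by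
      ext
      rw [coe_nndist, Real.dist_eq]
      push_cast
      rw [show ((k : ℝ) + 1) * h - k * h = h by ring, abs_of_nonneg h.coe_nonneg]
    rw [h2, charFun_gaussianReal]
    congr 1
    have h4 := congrArg NNReal.toReal h3
    simp only [mul_zero, Complex.ofReal_zero, zero_mul, zero_sub, NNReal.coe_mul, NNReal.coe_mk]
    erw [h4]
    push_cast
    ring
  have hsum : (fun ω => ∑ k ∈ Finset.range N, a k * (b ((k + 1 : ℕ) * h) ω - b (k * h) ω)) =
      fun ω => ∑ k : Fin N, a k * (b ((k + 1 : ℕ) * h) ω - b ((k : ℕ) * h) ω) := by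
    ext ω
    exact Finset.sum_range (fun k => a k * (b ((k + 1 : ℕ) * h) ω - b (k * h) ω))
  rw [hsum, hind.charFun_map_fun_sum_eq_prod fun k => (hmeas _ _).const_mul _, Finset.prod_apply]
  simp_rw [hone]
  rw [← Complex.exp_sum, Finset.sum_range]
  congr 1
  push_cast
  rw [← Finset.sum_neg_distrib, Finset.sum_mul, Finset.sum_div]

/-- The stochastic integrals of deterministic `C¹` functions against independent Brownian motions,
written by integration by parts, have a centred Gaussian sum, whose variance is given by the Itô
isometry. The characteristic function is the limit of those of the step approximations. -/
lemma integral_exp_wiener {n : ℕ} [IsProbabilityMeasure P] {B : Fin n → ℝ≥0 → Ω → ℝ}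
    (hB : ∀ i, IsBrownianReal (B i) P) (hind : iIndepFun (fun i ω t => B i t ω) P)
    {g g' : Fin n → ℝ → ℝ} (hg : ∀ i s, HasDerivAt (g i) (g' i s) s)
    (hg' : ∀ i, Continuous (g' i)) (T : ℝ≥0) {W : Ω → ℝ}
    (hW : ∀ᵐ ω ∂P, W ω = ∑ i, (g i T * B i T ω -
      ∫ s in (0 : ℝ)..T, g' i s * B i s.toNNReal ω)) :
    ∫ ω, Complex.exp (W ω * Complex.I) ∂P =
      Complex.exp (-((∑ i, ∫ s in (0 : ℝ)..T, g i s ^ 2 : ℝ) : ℂ) / 2) := by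
  set Z : ℕ → Fin n → Ω → ℝ := fun N i ω => ∑ k ∈ Finset.range N,
    g i ((k + 1 : ℕ) * (T / N)) * (B i ((k + 1 : ℕ) * (T / N)) ω - B i (k * (T / N)) ω) with hZ
  have hcont (i : Fin n) : Continuous (g i) :=
    continuous_iff_continuousAt.2 fun s => (hg i s).continuousAt
  have hmeas (N : ℕ) (i : Fin n) : AEMeasurable (Z N i) P := by
    have := fun t => (hB i).aemeasurable t
    exact Finset.aemeasurable_fun_sum _ fun k _ => ((this _).sub (this _)).const_mul _
  have hlim : ∀ᵐ ω ∂P, Tendsto (fun N => Complex.exp ((∑ i, Z N i ω : ℝ) * Complex.I)) atTop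
      (𝓝 (Complex.exp (W ω * Complex.I))) := by
    filter_upwards [hW, ae_all_iff.2 fun i => (hB i).cont,
      ae_all_iff.2 fun i => (hB i).eval_zero_ae_eq_zero] with ω h1 h2 h3
    have h4 : Tendsto (fun N => ∑ i, Z N i ω) atTop (𝓝 (W ω)) := by
      rw [h1]
      refine tendsto_finsetSum _ fun i _ => ?_
      have h5 := tendsto_sum_mul_increment T.2 (hg i) (hg' i)
        (b := fun s => B i s.toNNReal ω) ((h2 i).comp continuous_real_toNNReal)
      simp only [Real.toNNReal_zero, h3, mul_zero, sub_zero, NNReal.val_eq_coe,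
        Real.toNNReal_coe] at h5
      convert h5 using 1
      ext N
      refine Finset.sum_congr rfl fun k _ => ?_
      have h6 (m : ℕ) : ((m : ℝ) * ((T : ℝ) / N)).toNNReal = m * (T / N) := by
        rw [← NNReal.coe_natCast, ← NNReal.coe_natCast, ← NNReal.coe_div, ← NNReal.coe_mul,
          Real.toNNReal_coe]
      rw [h6, h6]
    have h7 : Continuous fun x : ℝ => Complex.exp (x * Complex.I) := by fun_prop
    exact (h7.tendsto _).comp h4
  have hint : Tendsto (fun N => ∫ ω, Complex.exp ((∑ i, Z N i ω : ℝ) * Complex.I) ∂P) atTop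
      (𝓝 (∫ ω, Complex.exp (W ω * Complex.I) ∂P)) := by
    refine tendsto_integral_of_dominated_convergence (fun _ => 1) (fun N => ?_)
      (integrable_const _) (fun N => ?_) hlim
    · have h1 : AEMeasurable (fun ω => ∑ i, Z N i ω) P :=
        Finset.aemeasurable_fun_sum _ fun i _ => hmeas N i
      have h7 : Continuous fun x : ℝ => Complex.exp (x * Complex.I) := by fun_prop
      exact (h7.measurable.comp_aemeasurable h1).aestronglyMeasurable
    · exact Eventually.of_forall fun ω => (Complex.norm_exp_ofReal_mul_I _).le
  -- the step approximations are Gaussian sums, with Riemann sums as variances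
  have hval (N : ℕ) : ∫ ω, Complex.exp ((∑ i, Z N i ω : ℝ) * Complex.I) ∂P =
      Complex.exp (-((∑ i, ∑ k ∈ Finset.range N,
        g i ((k + 1 : ℕ) * (T / N)) ^ 2 * (T / N) : ℝ) : ℂ) / 2) := by
    have hindZ : iIndepFun (fun i ω => Z N i ω) P := by
      refine hind.comp (fun i (b : ℝ≥0 → ℝ) => ∑ k ∈ Finset.range N,
        g i ((k + 1 : ℕ) * (T / N)) * (b ((k + 1 : ℕ) * (T / N)) - b (k * (T / N)))) fun i => ?_
      fun_prop
    have h1 := congrFun (hindZ.charFun_map_fun_sum_eq_prod (hmeas N)) 1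
    rw [charFun_apply_real, integral_map
      (Finset.aemeasurable_fun_sum _ fun i _ => hmeas N i) (by fun_prop), Finset.prod_apply] at h1
    simp only [Complex.ofReal_one, one_mul] at h1
    rw [h1]
    have h2 (i : Fin n) := charFun_sum_increment (hB i).toIsPreBrownianReal N (T / N)
      (fun k => g i ((k + 1 : ℕ) * (T / N))) 1
    rw [Finset.prod_congr rfl fun i _ => h2 i, ← Complex.exp_sum]
    congr 1
    push_cast
    simp only [one_pow, mul_one]
    rw [← Finset.sum_neg_distrib, Finset.sum_div]
  have hvar : Tendsto (fun N : ℕ => ∑ i, ∑ k ∈ Finset.range N,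
      g i ((k + 1 : ℕ) * (T / N)) ^ 2 * (T / N)) atTop
      (𝓝 (∑ i, ∫ s in (0 : ℝ)..T, g i s ^ 2)) := by
    refine tendsto_finsetSum _ fun i _ => ?_
    have hd (s : ℝ) : HasDerivAt (fun s => g i s ^ 2) (2 * g i s * g' i s) s := by
      simpa using (hg i s).fun_pow 2
    have hdc : Continuous fun s => 2 * g i s * g' i s := by
      have := hcont i; have := hg' i; fun_prop
    -- Riemann sums are Riemann–Stieltjes sums against the identity
    have h5 := tendsto_sum_mul_increment T.2 hd hdc (b := fun s => s) continuous_id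
    have h6 := intervalIntegral.integral_mul_deriv_eq_deriv_mul (a := 0) (b := (T : ℝ))
      (fun s _ => hd s) (fun s _ => hasDerivAt_id s) (hdc.intervalIntegrable _ _)
      (continuous_const.intervalIntegrable _ _)
    simp only [mul_one, id] at h6
    simp only [NNReal.val_eq_coe] at h5
    rw [h6]
    convert h5 using 1
    ext N
    refine Finset.sum_congr rfl fun k _ => ?_
    push_cast
    ring
  have h8 : Continuous fun x : ℝ => Complex.exp (-(x : ℂ) / 2) := by fun_prop
  have h9 := (h8.tendsto _).comp hvar
  simp_rw [hval] at hint
  exact tendsto_nhds_unique hint h9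

end Wiener

end LinearGaussian

/-! ### The particle system is Gaussian -/

namespace LinearGaussian
open Matrix Filter Topology
open scoped Matrix.Norms.L2Operator

variable {n : ℕ}

/-- The flow `exp (s ξ)` of the linear system `x' = ξ x`. -/
noncomputable def flow (ξ : Matrix (Fin n) (Fin n) ℝ) (s : ℝ) : Matrix (Fin n) (Fin n) ℝ :=
  NormedSpace.exp (s • ξ)

lemma flow_zero (ξ : Matrix (Fin n) (Fin n) ℝ) : flow ξ 0 = 1 := by simp [flow]

lemma hasDerivAt_flow (ξ : Matrix (Fin n) (Fin n) ℝ) (s : ℝ) :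
    HasDerivAt (flow ξ) (flow ξ s * ξ) s :=
  hasDerivAt_exp_smul_const ξ s

lemma continuous_flow (ξ : Matrix (Fin n) (Fin n) ℝ) : Continuous (flow ξ) :=
  continuous_iff_continuousAt.2 fun s => (hasDerivAt_flow ξ s).continuousAt

lemma flow_mul_comm (ξ : Matrix (Fin n) (Fin n) ℝ) (s : ℝ) : flow ξ s * ξ = ξ * flow ξ s :=
  (hasDerivAt_exp_smul_const ξ s).unique (hasDerivAt_exp_smul_const' ξ s)

lemma hasDerivAt_vecMul_flow (ξ : Matrix (Fin n) (Fin n) ℝ) (u : Fin n → ℝ) (j : Fin n) (s : ℝ) :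
    HasDerivAt (fun s => (u ᵥ* flow ξ s) j) ((u ᵥ* (flow ξ s * ξ)) j) s := by
  let L : Matrix (Fin n) (Fin n) ℝ →ₗ[ℝ] ℝ :=
    { toFun := fun A => (u ᵥ* A) j
      map_add' := fun A B => by simp [vecMul_add]
      map_smul' := fun c A => by simp [vecMul_smul] }
  exact L.toContinuousLinearMap.hasFDerivAt.comp_hasDerivAt s (hasDerivAt_flow ξ s)

/-- Variation of constants: every linear functional of a solution of `x = ∫ ξ x + b` is a sum of
Riemann–Stieltjes integrals against `b`, written by integration by parts. The `j`-th integrand is `s ↦ (uᵀ exp ((T - s) ξ))_j`; its value at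
`s = T` is left as `flow ξ (T - T)` to fit `integral_exp_wiener`. -/
lemma dotProduct_eq_of_integral_equation (ξ : Matrix (Fin n) (Fin n) ℝ) {x b : ℝ → Fin n → ℝ}
    (hx : Continuous x) {T : ℝ} (hT : 0 ≤ T)
    (hxb : ∀ t ∈ Set.Icc 0 T, ∀ i, x t i = (∫ s in (0 : ℝ)..t, (ξ *ᵥ x s) i) + b t i)
    (u : Fin n → ℝ) :
    u ⬝ᵥ x T = ∑ j, ((u ᵥ* flow ξ (T - T)) j * b T j -
      ∫ s in (0 : ℝ)..T, -((u ᵥ* (flow ξ (T - s) * ξ)) j) * b s j) := by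
  set y : Fin n → ℝ → ℝ := fun i t => ∫ s in (0 : ℝ)..t, (ξ *ᵥ x s) i with hy
  have hξx (i : Fin n) : Continuous fun s => (ξ *ᵥ x s) i := by fun_prop
  have hyd (i : Fin n) (s : ℝ) : HasDerivAt (y i) ((ξ *ᵥ x s) i) s :=
    intervalIntegral.integral_hasDerivAt_right ((hξx i).intervalIntegrable _ _)
      ((hξx i).stronglyMeasurableAtFilter _ _) (hξx i).continuousAt
  have hyc (i : Fin n) : Continuous (y i) :=
    continuous_iff_continuousAt.2 fun s => (hyd i s).continuousAt
  set g : Fin n → ℝ → ℝ := fun j s => (u ᵥ* flow ξ (T - s)) j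
  set g' : Fin n → ℝ → ℝ := fun j s => -((u ᵥ* (flow ξ (T - s) * ξ)) j) with hg'def
  have hg (j : Fin n) (s : ℝ) : HasDerivAt (g j) (g' j s) s := by
    have := (hasDerivAt_vecMul_flow ξ u j (T - s)).comp s ((hasDerivAt_id s).const_sub T)
    simpa [Function.comp_def] using this
  have hg' (j : Fin n) : Continuous (g' j) := by
    have := continuous_flow ξ
    simp only [hg'def]
    fun_prop
  -- `y` is differentiable although `x` is not, and the drift term cancels in the derivative
  have hd (s : ℝ) : HasDerivAt (fun s => ∑ j, g j s * y j s)
      (∑ j, g' j s * (y j s - x s j)) s := by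
    have h1 := HasDerivAt.fun_sum (u := Finset.univ)
      fun (j : Fin n) _ => (hg j s).fun_mul (hyd j s)
    refine h1.congr_deriv ?_
    have h2 : ∑ j, g j s * (ξ *ᵥ x s) j = ∑ j, -g' j s * x s j := by
      change (u ᵥ* flow ξ (T - s)) ⬝ᵥ (ξ *ᵥ x s) = _
      rw [dotProduct_mulVec, vecMul_vecMul]
      simp [hg'def, dotProduct]
    rw [Finset.sum_add_distrib, h2, ← Finset.sum_add_distrib]
    exact Finset.sum_congr rfl fun j _ => by ring
  have hftc := intervalIntegral.integral_eq_sub_of_hasDerivAt (a := 0) (b := T)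
    (fun s _ => hd s) (Continuous.intervalIntegrable (by fun_prop) _ _)
  have hy0 (j : Fin n) : y j 0 = 0 := by simp [hy]
  simp only [hy0, mul_zero, Finset.sum_const_zero, sub_zero] at hftc
  rw [intervalIntegral.integral_finsetSum
    fun j _ => Continuous.intervalIntegrable (by fun_prop) _ _] at hftc
  have hcongr (j : Fin n) : ∫ s in (0 : ℝ)..T, g' j s * (y j s - x s j) =
      -∫ s in (0 : ℝ)..T, g' j s * b s j := by
    rw [← intervalIntegral.integral_neg]
    refine intervalIntegral.integral_congr fun s hs => ?_
    rw [Set.uIcc_of_le hT] at hs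
    simp only [hxb s hs j]
    ring
  simp_rw [hcongr] at hftc
  have hgT (j : Fin n) : g j T = u j := by simp [g, flow_zero]
  rw [Finset.sum_sub_distrib, sub_eq_add_neg, ← Finset.sum_neg_distrib, hftc,
    ← Finset.sum_add_distrib]
  refine Finset.sum_congr rfl fun j _ => ?_
  rw [hxb T ⟨hT, le_rfl⟩ j]
  change _ = g j T * b T j + g j T * y j T
  rw [hgT]
  ring

/-- The covariance matrix `∫_0^T exp (s ξ) exp (s ξ)ᵀ ds` at time `T` of the particle system. -/
noncomputable def covMatrix (ξ : Matrix (Fin n) (Fin n) ℝ) (T : ℝ) : Matrix (Fin n) (Fin n) ℝ :=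
  Matrix.of fun i j => ∫ s in (0 : ℝ)..T, (flow ξ s * (flow ξ s)ᵀ) i j

lemma dotProduct_covMatrix_mulVec (ξ : Matrix (Fin n) (Fin n) ℝ) (T : ℝ) (u : Fin n → ℝ) :
    u ⬝ᵥ covMatrix ξ T *ᵥ u =
      ∫ s in (0 : ℝ)..T, (u ᵥ* flow ξ s) ⬝ᵥ (u ᵥ* flow ξ s) := by
  have hc := continuous_flow ξ
  have h1 (s : ℝ) : (u ᵥ* flow ξ s) ⬝ᵥ (u ᵥ* flow ξ s) =
      ∑ i, ∑ j, u i * ((flow ξ s * (flow ξ s)ᵀ) i j * u j) := by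
    rw [← dotProduct_mulVec, ← mulVec_transpose, mulVec_mulVec]
    simp only [dotProduct, mulVec, Finset.mul_sum]
  simp_rw [h1]
  rw [intervalIntegral.integral_finsetSum
    fun j _ => Continuous.intervalIntegrable (by fun_prop) _ _]
  simp only [dotProduct, mulVec, Finset.mul_sum, covMatrix, of_apply]
  refine Finset.sum_congr rfl fun i _ => ?_
  rw [intervalIntegral.integral_finsetSum
    fun j _ => Continuous.intervalIntegrable (by fun_prop) _ _]
  refine Finset.sum_congr rfl fun j _ => ?_
  rw [intervalIntegral.integral_const_mul, intervalIntegral.integral_mul_const]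

variable {Ω : Type*} [MeasurableSpace Ω] {P : Measure Ω} [IsProbabilityMeasure P]

/-- The particle system is a centred Gaussian vector at every time. By variation of constants, every
linear functional of it is a Wiener integral. -/
lemma IsParticleSystem.isCenteredGaussian {ξ : Matrix (Fin n) (Fin n) ℝ}
    {X : ℝ≥0 → Ω → Fin n → ℝ} (hX : IsParticleSystem ξ P X) (T : ℝ≥0) :
    IsCenteredGaussian (P.map (X T)) (covMatrix ξ T) := by
  obtain ⟨B, hB⟩ := hX
  intro u
  rw [integral_map (hB.aemeasurable T) (by fun_prop)]
  have hc := continuous_flow ξ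
  rw [integral_exp_wiener hB.brownian hB.indep (W := fun ω => u ⬝ᵥ X T ω)
    (g := fun j s => (u ᵥ* flow ξ (T - s)) j) (g' := fun j s => -((u ᵥ* (flow ξ (T - s) * ξ)) j))
    _ (fun j => by fun_prop) T]
  · -- reversal of time turns the variance into the quadratic form of `covMatrix`
    congr 3
    rw [← intervalIntegral.integral_finsetSum
      fun j _ => Continuous.intervalIntegrable (by fun_prop) _ _, dotProduct_covMatrix_mulVec]
    have h1 := intervalIntegral.integral_comp_sub_left (a := 0) (b := (T : ℝ))
      (fun s => (u ᵥ* flow ξ s) ⬝ᵥ (u ᵥ* flow ξ s)) (T : ℝ)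
    rw [sub_self, sub_zero] at h1
    rw [← h1]
    simp only [dotProduct, sq]
  · filter_upwards [hB.continuous_paths, hB.equation] with ω h1 h2
    have h3 := dotProduct_eq_of_integral_equation ξ (x := fun s => X s.toNNReal ω)
      (b := fun s i => B i s.toNNReal ω) (h1.comp continuous_real_toNNReal) T.2
      (fun t ht i => ?_) u
    · simpa using h3
    · have h4 := h2 t.toNNReal i
      rw [Real.coe_toNNReal t ht.1] at h4
      exact h4
  · intro j s
    have := (hasDerivAt_vecMul_flow ξ u j (T - s)).comp s ((hasDerivAt_id s).const_sub (T : ℝ))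
    simpa [Function.comp_def] using this

end LinearGaussian

/-! ### The independent projection and marginal laws -/

namespace LinearGaussian
open Matrix Filter Topology

variable {n : ℕ} {Ω : Type*} [MeasurableSpace Ω] {P : Measure Ω} [IsProbabilityMeasure P]

/-- The mean `m` of the independent projection solves `m = ∫ ξ m`, hence vanishes. The equation
shows that `m` is continuous, which is not part of the hypotheses. -/
lemma IsIndependentProjection.integral_eq_zero {ξ : Matrix (Fin n) (Fin n) ℝ}
    {Y : ℝ≥0 → Ω → Fin n → ℝ} (hY : IsIndependentProjection ξ P Y) (t : ℝ≥0) (i : Fin n) :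
    ∫ ω, Y t ω i ∂P = 0 := by
  obtain ⟨hint, B, hB⟩ := hY
  set m : ℝ → Fin n → ℝ := fun s i => ∫ ω, Y s.toNNReal ω i ∂P with hm
  set f : Fin n → ℝ → ℝ := fun i s => (ξ *ᵥ m s) i with hf
  have hfpos (i : Fin n) (t : ℝ≥0) : IntervalIntegrable (f i) volume 0 t := by
    obtain ⟨ω, hω⟩ := hB.drift_integrable.exists
    exact hω t i
  -- for negative times, `Real.toNNReal` makes `m` constant
  have hfneg (i : Fin n) (t : ℝ) (ht : t ≤ 0) : IntervalIntegrable (f i) volume 0 t := by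
    refine (intervalIntegrable_const (c := f i 0)).congr fun s hs => ?_
    rw [Set.uIoc_of_ge ht] at hs
    simp only [hf, hm, Real.toNNReal_of_nonpos hs.2, Real.toNNReal_zero]
  have hfint (i : Fin n) (t : ℝ) : IntervalIntegrable (f i) volume 0 t := by
    rcases le_total t 0 with ht | ht
    · exact hfneg i t ht
    · simpa [Real.coe_toNNReal t ht] using hfpos i t.toNNReal
  have hmeq (i : Fin n) (t : ℝ) (ht : 0 ≤ t) : m t i = ∫ s in (0 : ℝ)..t, f i s := by
    have h1 : ∫ ω, Y t.toNNReal ω i ∂P =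
        ∫ ω, ((∫ s in (0 : ℝ)..t, f i s) + B i t.toNNReal ω) ∂P := by
      refine integral_congr_ae ?_
      filter_upwards [hB.equation] with ω hω
      have := hω t.toNNReal i
      rw [Real.coe_toNNReal t ht] at this
      exact this
    simp only [hm]
    rw [h1, integral_add (integrable_const _) ((hB.brownian i).integrable_eval _),
      (hB.brownian i).integral_eval]
    simp
  have hcont : Continuous m := by
    refine continuous_pi fun i => ?_
    have h1 : (fun s => m s i) = fun s => ∫ r in (0 : ℝ)..max s 0, f i r := by
      ext s
      rw [← hmeq i _ (le_max_right _ _)]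
      simp only [hm]
      rcases le_total s 0 with hs | hs
      · rw [max_eq_right hs, Real.toNNReal_of_nonpos hs, Real.toNNReal_zero]
      · rw [max_eq_left hs]
    rw [h1]
    exact (intervalIntegral.continuous_primitive
      (fun a b => (hfint i a).symm.trans (hfint i b)) 0).comp (by fun_prop)
  have h := dotProduct_eq_of_integral_equation ξ (b := 0) hcont t.2
    (fun s hs i => by simpa using hmeq i s hs.1) (Pi.single i 1)
  simpa [hm] using h

/-- As its mean vanishes, the independent projection consists of independent Brownian motions: it
solves the particle system without interaction. -/
lemma IsIndependentProjection.isParticleSystem_zero {ξ : Matrix (Fin n) (Fin n) ℝ}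
    {Y : ℝ≥0 → Ω → Fin n → ℝ} (hY : IsIndependentProjection ξ P Y) : IsParticleSystem 0 P Y := by
  have h0 := hY.integral_eq_zero
  obtain ⟨-, B, hB⟩ := hY
  refine ⟨B, ?_⟩
  simpa [h0] using hB

lemma covMatrix_zero (T : ℝ) :
    covMatrix (0 : Matrix (Fin n) (Fin n) ℝ) T = T • 1 := by
  ext i j
  simp [covMatrix, flow]

/-- Extension by zero of a vector indexed by `v`. -/
noncomputable def extendZero (v : Finset (Fin n)) (u : v → ℝ) (i : Fin n) : ℝ :=
  if hi : i ∈ v then u ⟨i, hi⟩ else 0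

lemma extendZero_dotProduct (v : Finset (Fin n)) (u : v → ℝ) (y : Fin n → ℝ) :
    extendZero v u ⬝ᵥ y = u ⬝ᵥ fun i : v => y i := by
  simp only [dotProduct, extendZero]
  rw [← Finset.sum_subset (Finset.subset_univ v) (fun i _ hi => by simp [hi]),
    ← Finset.sum_coe_sort]
  simp

lemma extendZero_dotProduct_self (v : Finset (Fin n)) (u : v → ℝ) :
    extendZero v u ⬝ᵥ extendZero v u = u ⬝ᵥ u := by
  rw [extendZero_dotProduct]
  simp [extendZero]

lemma extendZero_dotProduct_mulVec (S : Matrix (Fin n) (Fin n) ℝ) (v : Finset (Fin n))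
    (u : v → ℝ) :
    extendZero v u ⬝ᵥ S *ᵥ extendZero v u = u ⬝ᵥ (S.submatrix (↑) (↑) : Matrix v v ℝ) *ᵥ u := by
  rw [extendZero_dotProduct]
  congr 1
  ext i
  change S i ⬝ᵥ extendZero v u = _
  rw [dotProduct_comm, extendZero_dotProduct, dotProduct_comm]
  rfl

omit [IsProbabilityMeasure P] in
lemma IsCenteredGaussian.marginalLaw {X : ℝ≥0 → Ω → Fin n → ℝ} {T : ℝ≥0}
    (hX : AEMeasurable (X T) P) {S : Matrix (Fin n) (Fin n) ℝ}
    (h : IsCenteredGaussian (P.map (X T)) S) (v : Finset (Fin n)) :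
    IsCenteredGaussian (LinearGaussian.marginalLaw P X T v)
      (S.submatrix (↑) (↑) : Matrix v v ℝ) := by
  intro u
  have h1 := h (extendZero v u)
  rw [extendZero_dotProduct_mulVec, integral_map hX (by fun_prop)] at h1
  simp_rw [extendZero_dotProduct] at h1
  have hXv : AEMeasurable (fun ω (i : v) => X T ω i) P :=
    (by fun_prop : Measurable fun (x : Fin n → ℝ) (i : v) => x i).comp_aemeasurable hX
  rw [LinearGaussian.marginalLaw, integral_map hXv (by fun_prop)]
  exact h1

end LinearGaussian

/-! ### Estimates on the matrix exponential -/

namespace LinearGaussian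
open Matrix Filter Topology
open scoped Matrix.Norms.L2Operator

variable {n : ℕ} (ξ : Matrix (Fin n) (Fin n) ℝ)

lemma opNorm_eq_norm : opNorm ξ = ‖ξ‖ := rfl

/-- For `n = 0` the norm of the identity matrix is `0`, so that Mathlib's `norm_pow_le` does not
apply directly. -/
lemma norm_pow_le_l2 (m : ℕ) : ‖ξ ^ m‖ ≤ ‖ξ‖ ^ m := by
  rcases isEmpty_or_nonempty (Fin n) with h | h
  · have h0 (A : Matrix (Fin n) (Fin n) ℝ) : ‖A‖ = 0 := by
      rw [norm_eq_zero]; exact Subsingleton.elim _ _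
    rw [h0 (ξ ^ m)]; positivity
  · exact norm_pow_le ξ m

lemma norm_transpose_l2 : ‖ξᵀ‖ = ‖ξ‖ := by
  rw [← conjTranspose_eq_transpose_of_trivial, l2_opNorm_conjTranspose]

lemma dotProduct_vecMul_self_le (u : Fin n → ℝ) :
    (u ᵥ* ξ) ⬝ᵥ (u ᵥ* ξ) ≤ ‖ξ‖ ^ 2 * (u ⬝ᵥ u) := by
  have h (w : Fin n → ℝ) : w ⬝ᵥ w = ‖WithLp.toLp 2 w‖ ^ 2 := by
    rw [EuclideanSpace.real_norm_sq_eq]; simp [dotProduct, sq]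
  have h1 := l2_opNorm_mulVec ξᵀ (WithLp.toLp 2 u)
  rw [norm_transpose_l2] at h1
  rw [h, h, ← mul_pow, ← mulVec_transpose]
  exact pow_le_pow_left₀ (norm_nonneg _) h1 2

lemma norm_flow_le (s : ℝ) : ‖flow ξ s‖ ≤ Real.exp (|s| * ‖ξ‖) := by
  have h1 := NormedSpace.exp_series_hasSum_exp' (𝕂 := ℝ) (s • ξ)
  have h2 := NormedSpace.expSeries_div_hasSum_exp (|s| * ‖ξ‖)
  rw [← Real.exp_eq_exp_ℝ] at h2
  rw [flow, ← h1.tsum_eq]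
  refine tsum_of_norm_bounded h2 fun m => ?_
  rw [norm_smul, smul_pow, norm_smul, norm_inv, norm_pow, Real.norm_natCast,
    Real.norm_eq_abs, mul_pow, div_eq_inv_mul]
  gcongr
  exact norm_pow_le_l2 ξ m

/-- The deviation `exp (s ξ) - 1` of the flow from the identity. -/
noncomputable def flowExcess (s : ℝ) : Matrix (Fin n) (Fin n) ℝ := flow ξ s - 1

lemma continuous_flowExcess : Continuous (flowExcess ξ) :=
  (continuous_flow ξ).sub continuous_const

lemma flowExcess_apply (s : ℝ) (i j : Fin n) :
    flowExcess ξ s i j = flow ξ s i j - (1 : Matrix (Fin n) (Fin n) ℝ) i j := rfl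

/-- `exp (s ξ) - 1` factors through `ξ` with a bounded second factor, `∫_0^s exp (r ξ) dr`. -/
lemma exists_flowExcess_eq_mul {s : ℝ} (hs : 0 ≤ s) :
    ∃ G : Matrix (Fin n) (Fin n) ℝ, flowExcess ξ s = ξ * G ∧ ‖G‖ ≤ s * Real.exp (s * ‖ξ‖) := by
  have hc := continuous_flow ξ
  refine ⟨∫ r in (0 : ℝ)..s, flow ξ r, ?_, ?_⟩
  · have h1 : ∫ r in (0 : ℝ)..s, ξ * flow ξ r = flow ξ s - flow ξ 0 := by
      refine intervalIntegral.integral_eq_sub_of_hasDerivAt (fun r _ => ?_)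
        (Continuous.intervalIntegrable (by fun_prop) _ _)
      rw [← flow_mul_comm]
      exact hasDerivAt_flow ξ r
    rw [flowExcess, ← flow_zero ξ, ← h1]
    have h2 := (ContinuousLinearMap.mul ℝ (Matrix (Fin n) (Fin n) ℝ) ξ).intervalIntegral_comp_comm
      (hc.intervalIntegrable (μ := volume) 0 s)
    exact h2
  · have h1 := intervalIntegral.norm_integral_le_of_norm_le_const (a := 0) (b := s) (f := flow ξ)
      (C := Real.exp (s * ‖ξ‖)) fun r hr => by
        rw [Set.uIoc_of_le hs] at hr
        refine (norm_flow_le ξ r).trans ?_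
        rw [abs_of_pos hr.1]
        gcongr
        exact hr.2
    rwa [sub_zero, abs_of_nonneg hs, mul_comm] at h1

lemma norm_flowExcess_le {s : ℝ} (hs : 0 ≤ s) :
    ‖flowExcess ξ s‖ ≤ ‖ξ‖ * (s * Real.exp (s * ‖ξ‖)) := by
  obtain ⟨G, h1, h2⟩ := exists_flowExcess_eq_mul ξ hs
  rw [h1]
  exact (norm_mul_le _ _).trans (by gcongr)

/-- Multiplication by `B` from the right enlarges the norm of each row at most by `‖B‖`. -/
lemma sum_mul_apply_sq_le (A B : Matrix (Fin n) (Fin n) ℝ) (i : Fin n) :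
    ∑ j, (A * B) i j ^ 2 ≤ ‖B‖ ^ 2 * ∑ j, A i j ^ 2 := by
  have := dotProduct_vecMul_self_le B (A i)
  simpa [dotProduct, ← sq, mul_apply_eq_vecMul] using this

lemma sum_flowExcess_sq_le {s : ℝ} (hs : 0 ≤ s) (i : Fin n) :
    ∑ j, flowExcess ξ s i j ^ 2 ≤ (s * Real.exp (s * ‖ξ‖)) ^ 2 * ∑ j, ξ i j ^ 2 := by
  obtain ⟨G, h1, h2⟩ := exists_flowExcess_eq_mul ξ hs
  rw [h1]
  refine (sum_mul_apply_sq_le ξ G i).trans ?_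
  gcongr

lemma flow_mul_flow_neg (s : ℝ) : flow ξ s * flow ξ (-s) = 1 := by
  rw [flow, flow, neg_smul, ← Matrix.exp_add_of_commute _ _ (Commute.refl (s • ξ)).neg_right]
  simp

lemma dotProduct_vecMul_flow_le {s : ℝ} (hs : 0 ≤ s) (u : Fin n → ℝ) :
    (u ᵥ* flow ξ s) ⬝ᵥ (u ᵥ* flow ξ s) ≤ Real.exp (2 * s * ‖ξ‖) * (u ⬝ᵥ u) := by
  refine (dotProduct_vecMul_self_le _ _).trans ?_
  have h := norm_flow_le ξ s
  have h0 : 0 ≤ u ⬝ᵥ u := by simpa [dotProduct] using Finset.sum_nonneg fun i _ => mul_self_nonneg (u i)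
  rw [abs_of_nonneg hs] at h
  rw [show 2 * s * ‖ξ‖ = s * ‖ξ‖ + s * ‖ξ‖ by ring, Real.exp_add, ← sq]
  gcongr

/-- The flow is bounded below because its inverse `exp (-s ξ)` is bounded above. -/
lemma le_dotProduct_vecMul_flow {s : ℝ} (hs : 0 ≤ s) (u : Fin n → ℝ) :
    Real.exp (-(2 * s * ‖ξ‖)) * (u ⬝ᵥ u) ≤ (u ᵥ* flow ξ s) ⬝ᵥ (u ᵥ* flow ξ s) := by
  have h1 := dotProduct_vecMul_self_le (flow ξ (-s)) (u ᵥ* flow ξ s)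
  rw [vecMul_vecMul, flow_mul_flow_neg, vecMul_one] at h1
  have h := norm_flow_le ξ (-s)
  rw [abs_neg, abs_of_nonneg hs] at h
  have h0 : 0 ≤ (u ᵥ* flow ξ s) ⬝ᵥ (u ᵥ* flow ξ s) := by
    simpa [dotProduct] using Finset.sum_nonneg fun i _ => mul_self_nonneg ((u ᵥ* flow ξ s) i)
  rw [Real.exp_neg, inv_mul_le_iff₀ (Real.exp_pos _)]
  refine h1.trans ?_
  rw [show 2 * s * ‖ξ‖ = s * ‖ξ‖ + s * ‖ξ‖ by ring, Real.exp_add, ← sq]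
  gcongr

/-- The entries of `exp (s ξ)` as power series. -/
lemma hasSum_flow_apply (s : ℝ) (i j : Fin n) :
    HasSum (fun m : ℕ => s ^ m / (m ! : ℝ) * (ξ ^ m) i j) (flow ξ s i j) := by
  have h1 := NormedSpace.exp_series_hasSum_exp' (𝕂 := ℝ) (s • ξ)
  let L : Matrix (Fin n) (Fin n) ℝ →ₗ[ℝ] ℝ :=
    { toFun := fun A => A i j
      map_add' := fun A B => rfl
      map_smul' := fun c A => rfl }
  have h2 : (fun m : ℕ => s ^ m / (m ! : ℝ) * (ξ ^ m) i j) =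
      fun m : ℕ => ((m ! : ℝ)⁻¹ • (s • ξ) ^ m) i j := by
    funext m
    rw [smul_pow, Matrix.smul_apply, Matrix.smul_apply, smul_eq_mul, smul_eq_mul]
    ring
  rw [h2]
  have h3 := L.toContinuousLinearMap.hasSum h1
  exact h3

/-- Term-by-term integration of the exponential series. -/
lemma hasSum_integral_flow_apply {T : ℝ} (hT : 0 ≤ T) (i j : Fin n) :
    HasSum (fun m : ℕ => T ^ (m + 1) / ((m + 1)! : ℝ) * (ξ ^ m) i j)
      (∫ s in (0 : ℝ)..T, flow ξ s i j) := by
  have h1 := intervalIntegral.hasSum_integral_of_dominated_convergence (μ := volume) (a := 0)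
    (b := T) (F := fun (m : ℕ) s => s ^ m / (m ! : ℝ) * (ξ ^ m) i j)
    (f := fun s => flow ξ s i j) (fun m _ => |T ^ m / (m ! : ℝ) * (ξ ^ m) i j|)
    (fun m => by fun_prop)
    (fun m => Filter.Eventually.of_forall fun s hs => ?_)
    (Filter.Eventually.of_forall fun s _ => (hasSum_flow_apply ξ T i j).summable.abs)
    intervalIntegrable_const
    (Filter.Eventually.of_forall fun s _ => hasSum_flow_apply ξ s i j)
  · have h2 : (fun m : ℕ => T ^ (m + 1) / ((m + 1)! : ℝ) * (ξ ^ m) i j) =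
        fun m : ℕ => ∫ s in (0 : ℝ)..T, s ^ m / (m ! : ℝ) * (ξ ^ m) i j := by
      funext m
      rw [intervalIntegral.integral_mul_const, intervalIntegral.integral_div, integral_pow,
      Nat.factorial_succ,
        zero_pow (Nat.succ_ne_zero m), sub_zero]
      push_cast
      field_simp
    rwa [h2]
  · rw [Set.uIoc_of_le hT] at hs
    rw [Real.norm_eq_abs, abs_mul, abs_mul, abs_div, abs_div, abs_pow, abs_pow, abs_of_pos hs.1,
      abs_of_nonneg hT]
    have := hs.1.le
    gcongr
    exact hs.2

variable {ξ}

lemma pow_apply_nonneg (hξ : ∀ i j, 0 ≤ ξ i j) (m : ℕ) (i j : Fin n) : 0 ≤ (ξ ^ m) i j := by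
  induction m generalizing j with
  | zero => rw [pow_zero, one_apply]; split_ifs <;> simp
  | succ m ih =>
    rw [pow_succ, mul_apply]
    exact Finset.sum_nonneg fun l _ => mul_nonneg (ih l) (hξ l j)

lemma flow_apply_mono (hξ : ∀ i j, 0 ≤ ξ i j) {s t : ℝ} (hs : 0 ≤ s) (hst : s ≤ t)
    (i j : Fin n) : flow ξ s i j ≤ flow ξ t i j := by
  refine hasSum_le (fun m => ?_) (hasSum_flow_apply ξ s i j) (hasSum_flow_apply ξ t i j)
  have := pow_apply_nonneg hξ m i j
  gcongr

lemma one_add_smul_le_flow (hξ : ∀ i j, 0 ≤ ξ i j) {s : ℝ} (hs : 0 ≤ s) (i j : Fin n) :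
    (1 : Matrix (Fin n) (Fin n) ℝ) i j + s * ξ i j ≤ flow ξ s i j := by
  have h := sum_le_hasSum (Finset.range 2) (fun m _ => ?_) (hasSum_flow_apply ξ s i j)
  · simpa [Finset.sum_range_succ] using h
  · have := pow_apply_nonneg hξ m i j
    positivity

end LinearGaussian

/-! ### The relative covariance and the diagonal series -/

namespace LinearGaussian
open Matrix Filter Topology
open scoped Matrix.Norms.L2Operator

variable {n : ℕ} {ξ : Matrix (Fin n) (Fin n) ℝ} {T : ℝ}

/-- The deviation of the covariance matrix of the particle system from that of the independent
projection, relative to the latter. -/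
noncomputable def relCov (ξ : Matrix (Fin n) (Fin n) ℝ) (T : ℝ) : Matrix (Fin n) (Fin n) ℝ :=
  T⁻¹ • covMatrix ξ T - 1

lemma smul_one_add_relCov (ξ : Matrix (Fin n) (Fin n) ℝ) (hT : 0 < T) :
    T • (1 + relCov ξ T) = covMatrix ξ T := by
  rw [relCov, add_sub_cancel, smul_smul, mul_inv_cancel₀ hT.ne', one_smul]

lemma isHermitian_relCov (ξ : Matrix (Fin n) (Fin n) ℝ) (T : ℝ) : (relCov ξ T).IsHermitian := by
  have h : (covMatrix ξ T)ᵀ = covMatrix ξ T := by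
    ext i j
    simp only [covMatrix, transpose_apply, of_apply, mul_apply, mul_comm]
  rw [Matrix.IsHermitian, conjTranspose_eq_transpose_of_trivial, relCov, transpose_sub,
    transpose_smul, h, transpose_one]

lemma dotProduct_one_add_relCov_mulVec (ξ : Matrix (Fin n) (Fin n) ℝ) (T : ℝ) (u : Fin n → ℝ) :
    u ⬝ᵥ (1 + relCov ξ T) *ᵥ u =
      T⁻¹ * ∫ s in (0 : ℝ)..T, (u ᵥ* flow ξ s) ⬝ᵥ (u ᵥ* flow ξ s) := by
  rw [relCov, add_sub_cancel, smul_mulVec, dotProduct_smul, dotProduct_covMatrix_mulVec,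
    smul_eq_mul]

lemma dotProduct_one_add_relCov_mulVec_le (ξ : Matrix (Fin n) (Fin n) ℝ) (hT : 0 < T)
    (u : Fin n → ℝ) :
    u ⬝ᵥ (1 + relCov ξ T) *ᵥ u ≤ Real.exp (2 * T * ‖ξ‖) * (u ⬝ᵥ u) := by
  have hc := continuous_flow ξ
  have h0 : 0 ≤ u ⬝ᵥ u := Finset.sum_nonneg fun i _ => mul_self_nonneg (u i)
  rw [dotProduct_one_add_relCov_mulVec, inv_mul_le_iff₀ hT]
  have h := intervalIntegral.integral_mono_on (μ := volume) hT.le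
    (Continuous.intervalIntegrable (by fun_prop) _ _) intervalIntegrable_const
    fun s hs => (dotProduct_vecMul_flow_le ξ hs.1 u).trans
      (show _ ≤ Real.exp (2 * T * ‖ξ‖) * (u ⬝ᵥ u) by gcongr; exact hs.2)
  rwa [intervalIntegral.integral_const, sub_zero, smul_eq_mul] at h

lemma le_dotProduct_one_add_relCov_mulVec (ξ : Matrix (Fin n) (Fin n) ℝ) (hT : 0 < T)
    (u : Fin n → ℝ) :
    Real.exp (-(2 * T * ‖ξ‖)) * (u ⬝ᵥ u) ≤ u ⬝ᵥ (1 + relCov ξ T) *ᵥ u := by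
  have hc := continuous_flow ξ
  have h0 : 0 ≤ u ⬝ᵥ u := Finset.sum_nonneg fun i _ => mul_self_nonneg (u i)
  rw [dotProduct_one_add_relCov_mulVec, le_inv_mul_iff₀ hT]
  have h := intervalIntegral.integral_mono_on (μ := volume) hT.le intervalIntegrable_const
    (Continuous.intervalIntegrable (by fun_prop) _ _)
    fun s hs => (show Real.exp (-(2 * T * ‖ξ‖)) * (u ⬝ᵥ u) ≤ _ by gcongr; exact hs.2).trans
      (le_dotProduct_vecMul_flow ξ hs.1 u)
  rwa [intervalIntegral.integral_const, sub_zero, smul_eq_mul] at h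

/-- With `F = exp (s ξ) - 1`, the relative deviation of the covariance is the time average of
`F + Fᵀ + F Fᵀ`. -/
lemma relCov_apply (ξ : Matrix (Fin n) (Fin n) ℝ) (hT : 0 < T) (i j : Fin n) :
    relCov ξ T i j = T⁻¹ * ∫ s in (0 : ℝ)..T, (flowExcess ξ s i j + flowExcess ξ s j i +
      (flowExcess ξ s * (flowExcess ξ s)ᵀ) i j) := by
  have hc := continuous_flow ξ
  have hF := continuous_flowExcess ξ
  have h1 (s : ℝ) : flowExcess ξ s i j + flowExcess ξ s j i +
      (flowExcess ξ s * (flowExcess ξ s)ᵀ) i j =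
      (flow ξ s * (flow ξ s)ᵀ) i j - (1 : Matrix (Fin n) (Fin n) ℝ) i j := by
    have h2 : flow ξ s * (flow ξ s)ᵀ - 1 = flowExcess ξ s + (flowExcess ξ s)ᵀ +
        flowExcess ξ s * (flowExcess ξ s)ᵀ := by
      rw [flowExcess, transpose_sub, transpose_one]; noncomm_ring
    rw [← Matrix.sub_apply, h2]
    rfl
  simp_rw [h1]
  rw [intervalIntegral.integral_sub (Continuous.intervalIntegrable (by fun_prop) _ _)
    intervalIntegrable_const, mul_sub]
  simp [relCov, covMatrix, hT.ne']

section Nonneg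

variable (hξ : ∀ i j, 0 ≤ ξ i j)
include hξ

lemma smul_le_flowExcess {s : ℝ} (hs : 0 ≤ s) (i j : Fin n) :
    s * ξ i j ≤ flowExcess ξ s i j := by
  have := one_add_smul_le_flow hξ hs i j
  rw [flowExcess_apply]; linarith

lemma flowExcess_nonneg {s : ℝ} (hs : 0 ≤ s) (i j : Fin n) : 0 ≤ flowExcess ξ s i j :=
  (mul_nonneg hs (hξ i j)).trans (smul_le_flowExcess hξ hs i j)

/-- All the terms in `relCov_apply` are nonnegative, and the first is at least `s ξ_ij`. -/
lemma smul_le_relCov (hT : 0 < T) (i j : Fin n) : T / 2 * ξ i j ≤ relCov ξ T i j := by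
  have hF := continuous_flowExcess ξ
  rw [relCov_apply ξ hT, le_inv_mul_iff₀ hT]
  have h := intervalIntegral.integral_mono_on (μ := volume) (f := fun s => s * ξ i j) hT.le
    (Continuous.intervalIntegrable (by fun_prop) _ _)
    (Continuous.intervalIntegrable (by fun_prop) _ _)
    fun s hs => (show s * ξ i j ≤ flowExcess ξ s i j + flowExcess ξ s j i +
      (flowExcess ξ s * (flowExcess ξ s)ᵀ) i j by
        have h1 := smul_le_flowExcess hξ hs.1 i j
        have h2 := flowExcess_nonneg hξ hs.1 j i
        have h3 : 0 ≤ (flowExcess ξ s * (flowExcess ξ s)ᵀ) i j := by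
          rw [mul_apply]
          exact Finset.sum_nonneg fun l _ =>
            mul_nonneg (flowExcess_nonneg hξ hs.1 i l) (flowExcess_nonneg hξ hs.1 j l)
        linarith)
  refine le_trans (le_of_eq ?_) h
  rw [intervalIntegral.integral_mul_const, integral_id]
  ring

/-- The entries of `F + Fᵀ + F Fᵀ` increase in time, so that their average is at most the final
value. -/
lemma relCov_le (hT : 0 < T) (i j : Fin n) :
    relCov ξ T i j ≤ flowExcess ξ T i j + flowExcess ξ T j i +
      (flowExcess ξ T * (flowExcess ξ T)ᵀ) i j := by
  have hF := continuous_flowExcess ξ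
  rw [relCov_apply ξ hT, inv_mul_le_iff₀ hT]
  have h := intervalIntegral.integral_mono_on (μ := volume) hT.le
    (Continuous.intervalIntegrable (u := fun s => flowExcess ξ s i j + flowExcess ξ s j i +
      (flowExcess ξ s * (flowExcess ξ s)ᵀ) i j) (by fun_prop) _ _) intervalIntegrable_const
    fun s hs => (show flowExcess ξ s i j + flowExcess ξ s j i +
      (flowExcess ξ s * (flowExcess ξ s)ᵀ) i j ≤ flowExcess ξ T i j + flowExcess ξ T j i +
      (flowExcess ξ T * (flowExcess ξ T)ᵀ) i j by
        have h1 (a b : Fin n) : flowExcess ξ s a b ≤ flowExcess ξ T a b := by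
          exact sub_le_sub_right (flow_apply_mono hξ hs.1 hs.2 a b) _
        have h3 : (flowExcess ξ s * (flowExcess ξ s)ᵀ) i j ≤
            (flowExcess ξ T * (flowExcess ξ T)ᵀ) i j := by
          rw [mul_apply, mul_apply]
          exact Finset.sum_le_sum fun l _ => mul_le_mul (h1 i l) (h1 j l)
            (flowExcess_nonneg hξ hs.1 j l) (flowExcess_nonneg hξ hT.le i l)
        linarith [h1 i j, h1 j i])
  rwa [intervalIntegral.integral_const, sub_zero, smul_eq_mul] at h

lemma le_sum_relCov_sq (hT : 0 < T) :
    (T / 2) ^ 2 * ∑ i, ∑ j, ξ i j ^ 2 ≤ ∑ i, ∑ j, relCov ξ T i j ^ 2 := by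
  simp_rw [Finset.mul_sum, ← mul_pow]
  refine Finset.sum_le_sum fun i _ => Finset.sum_le_sum fun j _ => ?_
  have := hξ i j
  exact pow_le_pow_left₀ (by positivity) (smul_le_relCov hξ hT i j) 2

lemma sum_relCov_sq_le (hT : 0 < T) {K : ℝ} (hK : K = T * Real.exp (T * ‖ξ‖)) :
    ∑ i, ∑ j, relCov ξ T i j ^ 2 ≤
      3 * (2 * K ^ 2 + ‖ξ‖ ^ 2 * K ^ 4) * ∑ i, ∑ j, ξ i j ^ 2 := by
  set F := flowExcess ξ T
  have hrow : ∑ i, ∑ j, F i j ^ 2 ≤ K ^ 2 * ∑ i, ∑ j, ξ i j ^ 2 := by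
    rw [Finset.mul_sum]
    exact Finset.sum_le_sum fun i _ => hK ▸ sum_flowExcess_sq_le ξ hT.le i
  have hnorm : ‖F‖ ≤ ‖ξ‖ * K := hK ▸ norm_flowExcess_le ξ hT.le
  have hprod : ∑ i, ∑ j, (F * Fᵀ) i j ^ 2 ≤ (‖ξ‖ * K) ^ 2 * ∑ i, ∑ j, F i j ^ 2 := by
    rw [Finset.mul_sum]
    refine Finset.sum_le_sum fun i _ => (sum_mul_apply_sq_le F Fᵀ i).trans ?_
    rw [norm_transpose_l2]
    gcongr
  have hcomm : ∑ i, ∑ j, F j i ^ 2 = ∑ i, ∑ j, F i j ^ 2 := Finset.sum_comm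
  calc ∑ i, ∑ j, relCov ξ T i j ^ 2
      ≤ ∑ i, ∑ j, 3 * (F i j ^ 2 + F j i ^ 2 + (F * Fᵀ) i j ^ 2) := by
        refine Finset.sum_le_sum fun i _ => Finset.sum_le_sum fun j _ => ?_
        have h0 : 0 ≤ relCov ξ T i j :=
          (mul_nonneg (by positivity) (hξ i j)).trans (smul_le_relCov hξ hT i j)
        have h1 := pow_le_pow_left₀ h0 (relCov_le hξ hT i j) 2
        refine h1.trans ?_
        nlinarith [sq_nonneg (F i j - F j i), sq_nonneg (F i j - (F * Fᵀ) i j),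
          sq_nonneg (F j i - (F * Fᵀ) i j)]
    _ = 3 * (2 * ∑ i, ∑ j, F i j ^ 2 + ∑ i, ∑ j, (F * Fᵀ) i j ^ 2) := by
        simp only [← Finset.mul_sum, Finset.sum_add_distrib, hcomm]
        ring
    _ ≤ 3 * (2 * (K ^ 2 * ∑ i, ∑ j, ξ i j ^ 2) +
          (‖ξ‖ * K) ^ 2 * (K ^ 2 * ∑ i, ∑ j, ξ i j ^ 2)) := by
        have := hprod.trans (mul_le_mul_of_nonneg_left hrow (sq_nonneg (‖ξ‖ * K)))
        linarith
    _ = _ := by ring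

end Nonneg

/-- The inner series `∑_{m ≥ 2} T^m / (m+1)! (ξ^m)_ii` of `D`, with the index shifted by `2`. -/
noncomputable def diagSeries (T : ℝ) (ξ : Matrix (Fin n) (Fin n) ℝ) (i : Fin n) : ℝ :=
  ∑' m : ℕ, T ^ (m + 2) / ((m + 3)! : ℝ) * (ξ ^ (m + 2)) i i

lemma D_eq_sum_diagSeries_sq : D T ξ = ∑ i, diagSeries T ξ i ^ 2 := rfl

/-- The terms `m = 0` and `m = 1` of the exponential series contribute `1` and `0`. -/
lemma hasSum_diagSeries (ξ : Matrix (Fin n) (Fin n) ℝ) (hdiag : ∀ i, ξ i i = 0) (hT : 0 < T)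
    (i : Fin n) :
    HasSum (fun m : ℕ => T ^ (m + 2) / ((m + 3)! : ℝ) * (ξ ^ (m + 2)) i i)
      (T⁻¹ * (∫ s in (0 : ℝ)..T, flow ξ s i i) - 1) := by
  have h1 := (hasSum_nat_add_iff' 2).2 ((hasSum_integral_flow_apply ξ hT.le i i).mul_left T⁻¹)
  simp only [Finset.sum_range_succ, Finset.range_zero, Finset.sum_empty, zero_add, pow_zero,
    pow_one, hdiag, mul_zero, add_zero, Nat.factorial_one, Nat.cast_one, div_one, one_apply_eq,
    mul_one, inv_mul_cancel₀ hT.ne'] at h1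
  have h2 : (fun m : ℕ => T ^ (m + 2) / ((m + 3)! : ℝ) * (ξ ^ (m + 2)) i i) =
      fun m : ℕ => T⁻¹ * (T ^ (m + 2 + 1) / ((m + 2 + 1)! : ℝ) * (ξ ^ (m + 2)) i i) := by
    funext m
    rw [pow_succ T (m + 2)]
    field_simp
  rwa [h2]

/-- The diagonal of the relative covariance splits into the series of `D` and the average of
the squared row norms of `exp (s ξ) - 1`. -/
lemma relCov_diag (ξ : Matrix (Fin n) (Fin n) ℝ) (hdiag : ∀ i, ξ i i = 0) (hT : 0 < T)
    (i : Fin n) :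
    relCov ξ T i i = 2 * diagSeries T ξ i +
      T⁻¹ * ∫ s in (0 : ℝ)..T, ∑ l, flowExcess ξ s i l ^ 2 := by
  have hc := continuous_flow ξ
  have hF := continuous_flowExcess ξ
  rw [relCov_apply ξ hT, diagSeries, (hasSum_diagSeries ξ hdiag hT i).tsum_eq]
  have h1 (s : ℝ) : flowExcess ξ s i i + flowExcess ξ s i i +
      (flowExcess ξ s * (flowExcess ξ s)ᵀ) i i =
      2 * flow ξ s i i - 2 + ∑ l, flowExcess ξ s i l ^ 2 := by
    simp only [mul_apply, transpose_apply, ← sq]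
    rw [flowExcess_apply, one_apply_eq]
    ring
  simp_rw [h1]
  rw [intervalIntegral.integral_add (Continuous.intervalIntegrable (by fun_prop) _ _)
    (Continuous.intervalIntegrable (by fun_prop) _ _),
    intervalIntegral.integral_sub (Continuous.intervalIntegrable (by fun_prop) _ _)
    intervalIntegrable_const, intervalIntegral.integral_const_mul]
  simp only [intervalIntegral.integral_const, sub_zero, smul_eq_mul]
  field_simp

lemma inv_mul_integral_row_le (ξ : Matrix (Fin n) (Fin n) ℝ) (hT : 0 < T) {K : ℝ}
    (hK : K = T * Real.exp (T * ‖ξ‖)) (i : Fin n) :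
    T⁻¹ * (∫ s in (0 : ℝ)..T, ∑ l, flowExcess ξ s i l ^ 2) ≤ K ^ 2 * ∑ j, ξ i j ^ 2 := by
  have hF := continuous_flowExcess ξ
  rw [inv_mul_le_iff₀ hT]
  have h := intervalIntegral.integral_mono_on (μ := volume) hT.le
    (Continuous.intervalIntegrable (u := fun s => ∑ l, flowExcess ξ s i l ^ 2) (by fun_prop) _ _)
    intervalIntegrable_const
    fun s hs => (sum_flowExcess_sq_le ξ hs.1 i).trans
      (show _ ≤ K ^ 2 * ∑ j, ξ i j ^ 2 by
        rw [hK]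
        have := hs.1
        gcongr <;> exact hs.2)
  rwa [intervalIntegral.integral_const, sub_zero, smul_eq_mul] at h

lemma le_inv_mul_integral_row (hξ : ∀ i j, 0 ≤ ξ i j) (hT : 0 < T) (i : Fin n) :
    T ^ 2 / 3 * ∑ j, ξ i j ^ 2 ≤
      T⁻¹ * (∫ s in (0 : ℝ)..T, ∑ l, flowExcess ξ s i l ^ 2) := by
  have hF := continuous_flowExcess ξ
  rw [le_inv_mul_iff₀ hT]
  have h := intervalIntegral.integral_mono_on (μ := volume) (f := fun s => s ^ 2 * ∑ j, ξ i j ^ 2)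
    hT.le (Continuous.intervalIntegrable (by fun_prop) _ _)
    (Continuous.intervalIntegrable (u := fun s => ∑ l, flowExcess ξ s i l ^ 2) (by fun_prop) _ _)
    fun s hs => by
      rw [Finset.mul_sum]
      refine Finset.sum_le_sum fun j _ => ?_
      rw [← mul_pow]
      exact pow_le_pow_left₀ (mul_nonneg hs.1 (hξ i j)) (smul_le_flowExcess hξ hs.1 i j) 2
  refine le_trans (le_of_eq ?_) h
  rw [intervalIntegral.integral_mul_const, integral_pow]
  norm_num
  ring

lemma summable_diagSeries (ξ : Matrix (Fin n) (Fin n) ℝ) (hdiag : ∀ i, ξ i i = 0) (hT : 0 < T)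
    (i : Fin n) :
    Summable fun m : ℕ => T ^ (m + 2) / ((m + 3)! : ℝ) * (ξ ^ (m + 2)) i i :=
  (hasSum_diagSeries ξ hdiag hT i).summable

lemma diagSeries_nonneg (hξ : ∀ i j, 0 ≤ ξ i j) (hT : 0 < T) (i : Fin n) :
    0 ≤ diagSeries T ξ i :=
  tsum_nonneg fun m => by
    have := pow_apply_nonneg hξ (m + 2) i i
    positivity

lemma le_diagSeries (hξ : ∀ i j, 0 ≤ ξ i j) (hdiag : ∀ i, ξ i i = 0) (hT : 0 < T) (i : Fin n) :
    T ^ 2 / 6 * ∑ j, ξ i j * ξ j i ≤ diagSeries T ξ i := by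
  have h := (summable_diagSeries ξ hdiag hT i).le_tsum 0 fun m _ => by
    have := pow_apply_nonneg hξ (m + 2) i i
    positivity
  refine le_trans (le_of_eq ?_) h
  simp [sq ξ, mul_apply, Nat.factorial]

/-- `(ξ^(m+2))_ii` is the pairing, through `ξ^m`, of the `i`-th row with the `i`-th column of `ξ`, so
that the Cauchy–Schwarz inequality applies. -/
lemma pow_add_two_apply_le (ξ : Matrix (Fin n) (Fin n) ℝ) (m : ℕ) (i : Fin n) :
    (ξ ^ (m + 2)) i i ≤ ‖ξ‖ ^ m * ((∑ j, ξ i j ^ 2 + ∑ j, ξ j i ^ 2) / 2) := by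
  set A := ξ * ξ ^ m
  have h1 : (ξ ^ (m + 2)) i i = ∑ j, A i j * ξ j i := by
    rw [pow_succ, pow_succ', mul_apply]
  have h2 : ∑ j, A i j ^ 2 ≤ (‖ξ‖ ^ m) ^ 2 * ∑ j, ξ i j ^ 2 := by
    refine (sum_mul_apply_sq_le ξ (ξ ^ m) i).trans ?_
    gcongr
    exact norm_pow_le_l2 ξ m
  have hr : 0 ≤ ∑ j, ξ i j ^ 2 := Finset.sum_nonneg fun j _ => sq_nonneg _
  have hc : 0 ≤ ∑ j, ξ j i ^ 2 := Finset.sum_nonneg fun j _ => sq_nonneg _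
  have h3 := Finset.sum_mul_sq_le_sq_mul_sq Finset.univ (fun j => A i j) fun j => ξ j i
  rw [h1]
  refine abs_le_of_sq_le_sq' ?_ (by positivity) |>.2
  refine h3.trans ((mul_le_mul_of_nonneg_right h2 hc).trans ?_)
  rw [mul_pow, mul_assoc]
  gcongr
  nlinarith [sq_nonneg (∑ j, ξ i j ^ 2 - ∑ j, ξ j i ^ 2)]

lemma diagSeries_le (ξ : Matrix (Fin n) (Fin n) ℝ) (hdiag : ∀ i, ξ i i = 0) (hT : 0 < T)
    (i : Fin n) :
    diagSeries T ξ i ≤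
      T ^ 2 * Real.exp (T * ‖ξ‖) * ((∑ j, ξ i j ^ 2 + ∑ j, ξ j i ^ 2) / 2) := by
  set q := (∑ j, ξ i j ^ 2 + ∑ j, ξ j i ^ 2) / 2 with hq
  have hq0 : 0 ≤ q := by positivity
  have h2 := NormedSpace.expSeries_div_hasSum_exp (T * ‖ξ‖)
  rw [← Real.exp_eq_exp_ℝ] at h2
  refine hasSum_le (fun m => ?_) (summable_diagSeries ξ hdiag hT i).hasSum
    ((h2.mul_left (T ^ 2)).mul_right q)
  have h3 : (m ! : ℝ) ≤ ((m + 3)! : ℝ) := by exact_mod_cast Nat.factorial_le (by omega)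
  calc T ^ (m + 2) / ((m + 3)! : ℝ) * (ξ ^ (m + 2)) i i
      ≤ T ^ (m + 2) / (m ! : ℝ) * (‖ξ‖ ^ m * q) := by
        have h4 := pow_add_two_apply_le ξ m i
        have h5 : 0 ≤ T ^ (m + 2) / ((m + 3)! : ℝ) := by positivity
        refine (mul_le_mul_of_nonneg_left h4 h5).trans ?_
        gcongr
    _ = T ^ 2 * ((T * ‖ξ‖) ^ m / m !) * q := by rw [mul_pow, pow_add]; ring

end LinearGaussian

/-! ### Averaging over subsets of coordinates -/

namespace LinearGaussian
open Matrix

variable {n : ℕ}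

/-- The number of `k`-element sets that contain both `i` and `j`, as a fraction of all
`k`-element sets. -/
lemma card_filter_mem_mem (hn : 2 ≤ n) {k : ℕ} (hk : 1 ≤ k) (hkn : k ≤ n) (i j : Fin n) :
    (((Finset.powersetCard k (Finset.univ : Finset (Fin n))).filter
      fun v => i ∈ v ∧ j ∈ v).card : ℝ) =
      n.choose k * ((k * (k - 1) : ℝ) / (n * (n - 1)) +
        if i = j then (k * (n - k) : ℝ) / (n * (n - 1)) else 0) := by
  have hn1 : (1 : ℝ) < n := by exact_mod_cast hn
  have hne : (n : ℝ) - 1 ≠ 0 := by linarith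
  obtain ⟨N, rfl⟩ : ∃ N, n = N + 1 := ⟨n - 1, by omega⟩
  obtain ⟨K, rfl⟩ : ∃ K, k = K + 1 := ⟨k - 1, by omega⟩
  have h1 : ((N + 1 : ℕ) : ℝ) * N.choose K = (N + 1).choose (K + 1) * (K + 1 : ℕ) := by
    exact_mod_cast Nat.add_one_mul_choose_eq N K
  have hset : ((Finset.powersetCard (K + 1) (Finset.univ : Finset (Fin (N + 1)))).filter
      fun v => i ∈ v ∧ j ∈ v) =
      (Finset.powersetCard (K + 1) (Finset.univ : Finset (Fin (N + 1)))).filter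
        fun v => {i, j} ⊆ v := by
    simp [Finset.insert_subset_iff]
  rw [hset]
  by_cases hij : i = j
  · subst hij
    rw [Finset.pair_eq_singleton,
      Finset.card_filter_powersetCard_subset _ _ _ (Finset.subset_univ _) (by simp)]
    simp only [Finset.card_univ, Fintype.card_fin, Finset.card_singleton, Nat.add_sub_cancel,
      if_true]
    push_cast at h1 hne ⊢
    field_simp
    linear_combination (N : ℝ) * h1
  · rw [if_neg hij, add_zero]
    rcases Nat.eq_zero_or_pos K with rfl | hK
    · have : (Finset.powersetCard (0 + 1) (Finset.univ : Finset (Fin (N + 1)))).filter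
          (fun v => {i, j} ⊆ v) = ∅ := by
        refine Finset.filter_eq_empty_iff.2 fun v hv hsub => ?_
        have h2 := Finset.card_le_card hsub
        rw [Finset.card_pair hij, (Finset.mem_powersetCard.1 hv).2] at h2
        omega
      rw [this]; simp
    · obtain ⟨N, rfl⟩ : ∃ N', N = N' + 1 := ⟨N - 1, by omega⟩
      obtain ⟨K, rfl⟩ : ∃ K', K = K' + 1 := ⟨K - 1, by omega⟩
      have h2 : ((N + 1 : ℕ) : ℝ) * N.choose K = (N + 1).choose (K + 1) * (K + 1 : ℕ) := by
        exact_mod_cast Nat.add_one_mul_choose_eq N K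
      rw [Finset.card_filter_powersetCard_subset _ _ _ (Finset.subset_univ _)
        (by rw [Finset.card_pair hij]; omega)]
      rw [Finset.card_pair hij]
      simp only [Finset.card_univ, Fintype.card_fin]
      rw [show N + 1 + 1 - 2 = N by omega, show K + 1 + 1 - 2 = K by omega]
      push_cast at h1 h2 hne ⊢
      field_simp
      linear_combination (N + 2 : ℝ) * h2 + (K + 1 : ℝ) * h1

/-- A double sum over the entries of a principal submatrix, summed over all `k`-element sets. The
diagonal carries the additional weight `k (n - k) / (n (n - 1))`, since `i ∈ v` is more likely than
`i, j ∈ v` with `i ≠ j`. -/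
lemma sum_powersetCard_sum_sum (hn : 2 ≤ n) {k : ℕ} (hk : 1 ≤ k) (hkn : k ≤ n)
    (f : Fin n → Fin n → ℝ) :
    ∑ v ∈ Finset.powersetCard k (Finset.univ : Finset (Fin n)), ∑ i ∈ v, ∑ j ∈ v, f i j =
      n.choose k * ((k * (k - 1) : ℝ) / (n * (n - 1)) * ∑ i, ∑ j, f i j +
        (k * (n - k) : ℝ) / (n * (n - 1)) * ∑ i, f i i) := by
  have h1 (v : Finset (Fin n)) : ∑ i ∈ v, ∑ j ∈ v, f i j =
      ∑ i, ∑ j, if i ∈ v ∧ j ∈ v then f i j else 0 := by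
    simp only [ite_and, Finset.sum_ite_irrel, Finset.sum_const_zero, Finset.sum_ite_mem,
      Finset.univ_inter]
  rw [Finset.sum_congr rfl fun v _ => h1 v]
  have h2 (i j : Fin n) : ∑ v ∈ Finset.powersetCard k (Finset.univ : Finset (Fin n)),
      (if i ∈ v ∧ j ∈ v then f i j else 0) =
      n.choose k * ((k * (k - 1) : ℝ) / (n * (n - 1)) +
        if i = j then (k * (n - k) : ℝ) / (n * (n - 1)) else 0) * f i j := by
    rw [← Finset.sum_filter, Finset.sum_const, nsmul_eq_mul, card_filter_mem_mem hn hk hkn]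
  rw [Finset.sum_comm]
  simp_rw [fun i => Finset.sum_comm (s := Finset.powersetCard k (Finset.univ : Finset (Fin n)))
    (t := Finset.univ) (f := fun v j => if i ∈ v ∧ j ∈ v then f i j else 0), h2]
  simp only [mul_add, add_mul, Finset.sum_add_distrib, mul_ite, ite_mul, mul_zero, zero_mul,
    Finset.sum_ite_eq, Finset.mem_univ, if_true, ← Finset.mul_sum, mul_assoc]

variable {Ω Ω' : Type*} [MeasurableSpace Ω] [MeasurableSpace Ω']
  {P : Measure Ω} [IsProbabilityMeasure P] {P' : Measure Ω'} [IsProbabilityMeasure P']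
  {X : ℝ≥0 → Ω → Fin n → ℝ} {Y : ℝ≥0 → Ω' → Fin n → ℝ} {ξ : Matrix (Fin n) (Fin n) ℝ}

omit [IsProbabilityMeasure P] in
lemma IsParticleSystem.aemeasurable (hX : IsParticleSystem ξ P X) (t : ℝ≥0) :
    AEMeasurable (X t) P := by
  obtain ⟨B, hB⟩ := hX
  exact hB.aemeasurable t

lemma isProbabilityMeasure_marginalLaw {t : ℝ≥0} (hX : AEMeasurable (X t) P)
    (v : Finset (Fin n)) : IsProbabilityMeasure (marginalLaw P X t v) :=
  Measure.isProbabilityMeasure_map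
    ((by fun_prop : Measurable fun (x : Fin n → ℝ) (i : v) => x i).comp_aemeasurable hX)

/-- The relative entropy of the laws of the coordinates in `v` is comparable to the squared
Frobenius norm of the corresponding principal submatrix of `relCov`. -/
lemma klDiv_marginalLaw {T : ℝ≥0} (hT : 0 < T) (hX : IsParticleSystem ξ P X)
    (hY : IsIndependentProjection ξ P' Y) (v : Finset (Fin n)) :
    ∃ h : ℝ, klDiv (marginalLaw P X T v) (marginalLaw P' Y T v) = ENNReal.ofReal h ∧
      (∑ i ∈ v, ∑ j ∈ v, relCov ξ T i j ^ 2) / (4 * (Real.exp (2 * T * opNorm ξ) + 1)) ≤ h ∧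
      h ≤ (∑ i ∈ v, ∑ j ∈ v, relCov ξ T i j ^ 2) / (2 * Real.exp (-(2 * T * opNorm ξ))) := by
  have hT' : (0 : ℝ) < T := hT
  have hY0 := hY.isParticleSystem_zero
  have := isProbabilityMeasure_marginalLaw (hX.aemeasurable T) v
  have := isProbabilityMeasure_marginalLaw (hY0.aemeasurable T) v
  have hμ := (hX.isCenteredGaussian T).marginalLaw (hX.aemeasurable T) v
  have hν := (hY0.isCenteredGaussian T).marginalLaw (hY0.aemeasurable T) v
  have hinj : Function.Injective fun i : v => (i : Fin n) := Subtype.val_injective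
  have hone : ((1 : Matrix (Fin n) (Fin n) ℝ).submatrix (↑) (↑) : Matrix v v ℝ) = 1 :=
    submatrix_one _ hinj
  have hadd : (((1 : Matrix (Fin n) (Fin n) ℝ) + relCov ξ T).submatrix (↑) (↑) : Matrix v v ℝ) =
      1 + (relCov ξ T).submatrix (↑) (↑) := by
    rw [submatrix_add, Pi.add_apply, Pi.add_apply, hone]
  rw [← smul_one_add_relCov ξ hT', submatrix_smul, Pi.smul_apply, Pi.smul_apply, hadd] at hμ
  rw [covMatrix_zero, submatrix_smul, Pi.smul_apply, Pi.smul_apply, hone] at hν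
  have hsum : ∑ i : v, ∑ j : v, (relCov ξ T).submatrix (↑) (↑) i j ^ 2 =
      ∑ i ∈ v, ∑ j ∈ v, relCov ξ T i j ^ 2 := by
    rw [← Finset.sum_coe_sort v fun i => ∑ j ∈ v, relCov ξ T i j ^ 2]
    refine Finset.sum_congr rfl fun i _ => ?_
    rw [← Finset.sum_coe_sort v fun j => relCov ξ T i j ^ 2]
    rfl
  have h := klDiv_isCenteredGaussian ((isHermitian_relCov ξ T).submatrix _) hT.ne' hμ hν
    (Real.exp_pos (-(2 * T * opNorm ξ))) (β := Real.exp (2 * T * opNorm ξ)) (fun u => ?_)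
    (fun u => ?_)
  · rwa [hsum] at h
  · rw [← hadd, ← extendZero_dotProduct_mulVec, ← extendZero_dotProduct_self]
    exact le_dotProduct_one_add_relCov_mulVec ξ hT' _
  · rw [← hadd, ← extendZero_dotProduct_mulVec, ← extendZero_dotProduct_self]
    exact dotProduct_one_add_relCov_mulVec_le ξ hT' _

/-- The average entropy is comparable to the average squared Frobenius norm of the principal
submatrices of `relCov`. -/
lemma avgEntropy_comparable {T : ℝ≥0} (hT : 0 < T) (hX : IsParticleSystem ξ P X)
    (hY : IsIndependentProjection ξ P' Y) (hn : 2 ≤ n) {k : ℕ} (hk : 1 ≤ k) (hkn : k ≤ n) {A : ℝ}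
    (hA : A = (k * (k - 1) : ℝ) / (n * (n - 1)) * ∑ i, ∑ j, relCov ξ T i j ^ 2 +
        (k * (n - k) : ℝ) / (n * (n - 1)) * ∑ i, relCov ξ T i i ^ 2) :
    ∃ h : ℝ, avgEntropy P X P' Y T k = ENNReal.ofReal h ∧
      A / (4 * (Real.exp (2 * T * opNorm ξ) + 1)) ≤ h ∧
      h ≤ A / (2 * Real.exp (-(2 * T * opNorm ξ))) := by
  choose h h1 h2 h3 using fun v : Finset (Fin n) => klDiv_marginalLaw hT hX hY v
  have hc : (0 : ℝ) < n.choose k := by exact_mod_cast Nat.choose_pos hkn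
  have hS := sum_powersetCard_sum_sum hn hk hkn fun i j => relCov ξ T i j ^ 2
  rw [← hA] at hS
  have h0 (v : Finset (Fin n)) : 0 ≤ h v := le_trans (by positivity) (h2 v)
  refine ⟨(∑ v ∈ Finset.powersetCard k (Finset.univ : Finset (Fin n)), h v) / n.choose k,
    ?_, ?_, ?_⟩
  · simp only [avgEntropy, h1]
    rw [← ENNReal.ofReal_sum_of_nonneg fun v _ => h0 v, ENNReal.ofReal_div_of_pos hc,
      ENNReal.ofReal_natCast]
  · rw [le_div_iff₀ hc, div_mul_eq_mul_div, mul_comm A, ← hS, Finset.sum_div]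
    exact Finset.sum_le_sum fun v _ => h2 v
  · rw [div_le_iff₀ hc, div_mul_eq_mul_div, mul_comm A, ← hS, Finset.sum_div]
    exact Finset.sum_le_sum fun v _ => h3 v

section Bounds

variable {T : ℝ}

/-- On the diagonal there is no cancellation, as both terms of `relCov_diag` are nonnegative. -/
lemma le_sum_relCov_diag_sq (hξ : ∀ i j, 0 ≤ ξ i j) (hdiag : ∀ i, ξ i i = 0) (hT : 0 < T) :
    min 4 (T ^ 4 / 9) * (D T ξ + rowQuartic ξ) ≤ ∑ i, relCov ξ T i i ^ 2 := by
  rw [D_eq_sum_diagSeries_sq, rowQuartic, ← Finset.sum_add_distrib, Finset.mul_sum]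
  refine Finset.sum_le_sum fun i _ => ?_
  have h1 := diagSeries_nonneg hξ hT i
  have h2 := le_inv_mul_integral_row hξ hT i
  have h3 : 0 ≤ ∑ j, ξ i j ^ 2 := by positivity
  rw [relCov_diag ξ hdiag hT]
  set d := diagSeries T ξ i
  set w := T⁻¹ * ∫ s in (0 : ℝ)..T, ∑ l, flowExcess ξ s i l ^ 2
  set r := ∑ j, ξ i j ^ 2
  have h4 : 0 ≤ T ^ 2 / 3 * r := by positivity
  have h5 : (T ^ 2 / 3 * r) ^ 2 ≤ w ^ 2 := pow_le_pow_left₀ h4 h2 2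
  have h6 := mul_le_mul_of_nonneg_right (min_le_left 4 (T ^ 4 / 9)) (sq_nonneg d)
  have h7 := mul_le_mul_of_nonneg_right (min_le_right 4 (T ^ 4 / 9)) (sq_nonneg r)
  have h8 : 0 ≤ d * w := mul_nonneg h1 (h4.trans h2)
  nlinarith

lemma sum_relCov_diag_sq_le (hξ : ∀ i j, 0 ≤ ξ i j) (hdiag : ∀ i, ξ i i = 0) (hT : 0 < T) {K : ℝ}
    (hK : K = T * Real.exp (T * opNorm ξ)) :
    ∑ i, relCov ξ T i i ^ 2 ≤ (8 + 2 * K ^ 4) * (D T ξ + rowQuartic ξ) := by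
  rw [D_eq_sum_diagSeries_sq, rowQuartic, ← Finset.sum_add_distrib, Finset.mul_sum]
  refine Finset.sum_le_sum fun i _ => ?_
  have h2 := le_inv_mul_integral_row hξ hT i
  have h3 : 0 ≤ ∑ j, ξ i j ^ 2 := by positivity
  have h4 := inv_mul_integral_row_le ξ hT hK i
  rw [relCov_diag ξ hdiag hT]
  set d := diagSeries T ξ i
  set w := T⁻¹ * ∫ s in (0 : ℝ)..T, ∑ l, flowExcess ξ s i l ^ 2
  set r := ∑ j, ξ i j ^ 2
  have h5 : 0 ≤ w := le_trans (by positivity) h2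
  have h6 : w ^ 2 ≤ (K ^ 2 * r) ^ 2 := pow_le_pow_left₀ h5 h4 2
  have h7 : 0 ≤ K ^ 4 * d ^ 2 := by positivity
  nlinarith [sq_nonneg (2 * d - w), sq_nonneg r]

lemma le_D (hξ : ∀ i j, 0 ≤ ξ i j) (hdiag : ∀ i, ξ i i = 0) (hT : 0 < T) :
    (T ^ 2 / 6) ^ 2 * ∑ i, (∑ j, ξ i j * ξ j i) ^ 2 ≤ D T ξ := by
  rw [D_eq_sum_diagSeries_sq, Finset.mul_sum]
  refine Finset.sum_le_sum fun i _ => ?_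
  rw [← mul_pow]
  refine pow_le_pow_left₀ (mul_nonneg (by positivity) ?_) (le_diagSeries hξ hdiag hT i) 2
  exact Finset.sum_nonneg fun j _ => mul_nonneg (hξ i j) (hξ j i)

lemma D_le (hξ : ∀ i j, 0 ≤ ξ i j) (hdiag : ∀ i, ξ i i = 0) (hT : 0 < T) :
    D T ξ ≤ (T ^ 2 * Real.exp (T * opNorm ξ)) ^ 2 *
      (∑ i, (∑ j, ξ i j ^ 2) ^ 2 + ∑ i, (∑ j, ξ j i ^ 2) ^ 2) := by
  rw [D_eq_sum_diagSeries_sq, ← Finset.sum_add_distrib, Finset.mul_sum]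
  refine Finset.sum_le_sum fun i _ => ?_
  refine (pow_le_pow_left₀ (diagSeries_nonneg hξ hT i) (diagSeries_le ξ hdiag hT i) 2).trans ?_
  rw [mul_pow, opNorm_eq_norm]
  gcongr
  nlinarith [sq_nonneg (∑ j, ξ i j ^ 2 - ∑ j, ξ j i ^ 2), sq_nonneg (∑ j, ξ i j ^ 2),
    sq_nonneg (∑ j, ξ j i ^ 2)]

lemma D_le_of_isSymm (hξ : ∀ i j, 0 ≤ ξ i j) (hdiag : ∀ i, ξ i i = 0) (hT : 0 < T)
    (hs : ξ.IsSymm) :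
    D T ξ ≤ 2 * (T ^ 2 * Real.exp (T * opNorm ξ)) ^ 2 * rowQuartic ξ := by
  have h := D_le hξ hdiag hT
  have h1 : ∑ i, (∑ j, ξ j i ^ 2) ^ 2 = rowQuartic ξ :=
    Finset.sum_congr rfl fun i _ => by simp_rw [fun j => hs.apply i j]
  rw [h1] at h
  calc D T ξ ≤ _ := h
    _ = _ := by rw [rowQuartic]; ring

lemma D_nonneg (T : ℝ) (ξ : Matrix (Fin n) (Fin n) ℝ) : 0 ≤ D T ξ :=
  Finset.sum_nonneg fun _ _ => sq_nonneg _

lemma rowQuartic_nonneg (ξ : Matrix (Fin n) (Fin n) ℝ) : 0 ≤ rowQuartic ξ :=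
  Finset.sum_nonneg fun _ _ => sq_nonneg _

end Bounds

end LinearGaussian

/-! ### The two-sided entropy bounds -/

namespace LinearGaussian

lemma profile_mono {n k : ℕ} (hn : 2 ≤ n) (hkn : k ≤ n) (ξ : Matrix (Fin n) (Fin n) ℝ)
    {R R' : ℝ} (h : R ≤ R') : profile k ξ R ≤ profile k ξ R' := by
  have h1 : (2 : ℝ) ≤ n := by exact_mod_cast hn
  have h2 : (k : ℝ) ≤ n := by exact_mod_cast hkn
  have h3 : 0 ≤ (k * (n - k) : ℝ) / (n * (n - 1)) :=
    div_nonneg (mul_nonneg (by positivity) (by linarith)) (mul_nonneg (by linarith) (by linarith))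
  unfold profile
  gcongr

lemma profile_nonneg {n k : ℕ} (hn : 2 ≤ n) (hk : 1 ≤ k) (hkn : k ≤ n)
    (ξ : Matrix (Fin n) (Fin n) ℝ) {R : ℝ} (hR : 0 ≤ R) : 0 ≤ profile k ξ R := by
  have h1 : (2 : ℝ) ≤ n := by exact_mod_cast hn
  have h2 : (1 : ℝ) ≤ k := by exact_mod_cast hk
  refine le_trans ?_ (profile_mono hn hkn ξ hR)
  unfold profile
  rw [mul_zero, add_zero]
  exact mul_nonneg (div_nonneg (mul_nonneg (by linarith) (by linarith))
    (mul_nonneg (by linarith) (by linarith))) (by positivity)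

lemma profile_mul_le {n k : ℕ} (hn : 2 ≤ n) (hk : 1 ≤ k) (ξ : Matrix (Fin n) (Fin n) ℝ) {a R : ℝ}
    (ha : 1 ≤ a) : profile k ξ (a * R) ≤ a * profile k ξ R := by
  have h1 : (2 : ℝ) ≤ n := by exact_mod_cast hn
  have h2 : (1 : ℝ) ≤ k := by exact_mod_cast hk
  have h3 : 0 ≤ (k * (k - 1) : ℝ) / (n * (n - 1)) * ∑ i, ∑ j, ξ i j ^ 2 :=
    mul_nonneg (div_nonneg (mul_nonneg (by linarith) (by linarith))
      (mul_nonneg (by linarith) (by linarith))) (by positivity)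
  unfold profile
  nlinarith

/-- The average entropy is comparable to `profile k ξ (D T ξ + rowQuartic ξ)`, with constants that
depend on `T` and `ρ` only. -/
lemma exists_avgEntropy_bounds {n : ℕ} {Ω Ω' : Type*} [MeasurableSpace Ω] [MeasurableSpace Ω']
    {P : Measure Ω} [IsProbabilityMeasure P] {P' : Measure Ω'} [IsProbabilityMeasure P']
    {X : ℝ≥0 → Ω → Fin n → ℝ} {Y : ℝ≥0 → Ω' → Fin n → ℝ} {ξ : Matrix (Fin n) (Fin n) ℝ}
    {T : ℝ≥0} (hT : 0 < T) (hξ : ∀ i j, 0 ≤ ξ i j) (hdiag : ∀ i, ξ i i = 0) {ρ : ℝ}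
    (hρ : opNorm ξ = ρ) (hX : IsParticleSystem ξ P X) (hY : IsIndependentProjection ξ P' Y)
    (hn : 2 ≤ n) {k : ℕ} (hk : 1 ≤ k) (hkn : k ≤ n) {c₁ C₁ K c C : ℝ}
    (hc₁ : c₁ = 1 / (4 * (Real.exp (2 * T * ρ) + 1)))
    (hC₁ : C₁ = 1 / (2 * Real.exp (-(2 * T * ρ)))) (hK : K = T * Real.exp (T * ρ))
    (hc : c = c₁ * min ((T / 2 : ℝ) ^ 2) (min 4 ((T : ℝ) ^ 4 / 9)))
    (hC : C = C₁ * (3 * (2 * K ^ 2 + ρ ^ 2 * K ^ 4) + (8 + 2 * K ^ 4))) :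
    ENNReal.ofReal (c * profile k ξ (D T ξ + rowQuartic ξ)) ≤ avgEntropy P X P' Y T k ∧
      avgEntropy P X P' Y T k ≤ ENNReal.ofReal (C * profile k ξ (D T ξ + rowQuartic ξ)) := by
  have hT' : (0 : ℝ) < T := hT
  have h1 : (2 : ℝ) ≤ n := by exact_mod_cast hn
  have h2 : (1 : ℝ) ≤ k := by exact_mod_cast hk
  have h3 : (k : ℝ) ≤ n := by exact_mod_cast hkn
  have hp : 0 ≤ (k * (k - 1) : ℝ) / (n * (n - 1)) :=
    div_nonneg (mul_nonneg (by linarith) (by linarith)) (mul_nonneg (by linarith) (by linarith))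
  have hq : 0 ≤ (k * (n - k) : ℝ) / (n * (n - 1)) :=
    div_nonneg (mul_nonneg (by linarith) (by linarith)) (mul_nonneg (by linarith) (by linarith))
  obtain ⟨A, hA⟩ : ∃ A : ℝ, A = (k * (k - 1) : ℝ) / (n * (n - 1)) * ∑ i, ∑ j, relCov ξ T i j ^ 2 +
      (k * (n - k) : ℝ) / (n * (n - 1)) * ∑ i, relCov ξ T i i ^ 2 := ⟨_, rfl⟩
  obtain ⟨h, heq, hlow, hup⟩ := avgEntropy_comparable hT hX hY hn hk hkn hA
  rw [hρ, div_eq_mul_one_div, mul_comm, ← hc₁] at hlow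
  rw [hρ, div_eq_mul_one_div, mul_comm, ← hC₁] at hup
  have hW1 := le_sum_relCov_sq hξ hT'
  have hW2 := sum_relCov_sq_le hξ hT' rfl
  have hd1 := le_sum_relCov_diag_sq hξ hdiag hT'
  have hd2 := sum_relCov_diag_sq_le hξ hdiag hT' rfl
  rw [← opNorm_eq_norm, hρ, ← hK] at hW2
  rw [hρ, ← hK] at hd2
  have hR : 0 ≤ D T ξ + rowQuartic ξ := add_nonneg (D_nonneg _ _) (rowQuartic_nonneg _)
  have hS : 0 ≤ ∑ i, ∑ j, ξ i j ^ 2 := by positivity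
  have hc₁0 : 0 ≤ c₁ := by rw [hc₁]; positivity
  have hC₁0 : 0 ≤ C₁ := by rw [hC₁]; positivity
  have hK0 : 0 ≤ 3 * (2 * K ^ 2 + ρ ^ 2 * K ^ 4) := by positivity
  have hK0' : 0 ≤ 8 + 2 * K ^ 4 := by positivity
  rw [heq]
  constructor
  · refine ENNReal.ofReal_le_ofReal (le_trans ?_ hlow)
    rw [hc, mul_assoc]
    refine mul_le_mul_of_nonneg_left ?_ hc₁0
    rw [profile, mul_add, mul_left_comm, mul_left_comm (min _ _) _ (_ + _), hA]
    gcongr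
    · exact (mul_le_mul_of_nonneg_right (min_le_left _ _) hS).trans hW1
    · exact (mul_le_mul_of_nonneg_right (min_le_right _ _) hR).trans hd1
  · refine ENNReal.ofReal_le_ofReal (le_trans hup ?_)
    rw [hC, mul_assoc C₁]
    refine mul_le_mul_of_nonneg_left ?_ hC₁0
    rw [profile, mul_add (_ + _) (_ * _), mul_left_comm, mul_left_comm (_ + _) _ (_ + rowQuartic ξ),
      hA]
    gcongr
    · exact hW2.trans (mul_le_mul_of_nonneg_right (by linarith) hS)
    · exact hd2.trans (mul_le_mul_of_nonneg_right (by linarith) hR)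

end LinearGaussian

theorem theorem2p15 (T : ℝ≥0) (hT : 0 < T) (ρ : ℝ) :
    ∃ c C : ℝ, 0 < c ∧ 0 < C ∧
      ∀ (n : ℕ), 2 ≤ n → ∀ (ξ : Matrix (Fin n) (Fin n) ℝ),
        (∀ i j, 0 ≤ ξ i j) → (∀ i, ξ i i = 0) → LinearGaussian.opNorm ξ = ρ →
        -- the average entropy, for `T ≤ log 2 / (2 ρ)`
        (2 * ρ * T ≤ Real.log 2 →
          ∀ (Ω Ω' : Type*) [MeasurableSpace Ω] [MeasurableSpace Ω']
            (P : Measure Ω) [IsProbabilityMeasure P] (P' : Measure Ω') [IsProbabilityMeasure P']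
            (X : ℝ≥0 → Ω → Fin n → ℝ) (Y : ℝ≥0 → Ω' → Fin n → ℝ),
            LinearGaussian.IsParticleSystem ξ P X →
            LinearGaussian.IsIndependentProjection ξ P' Y →
            ∀ k : ℕ, 1 ≤ k → k ≤ n →
              (ENNReal.ofReal (c * LinearGaussian.profile k ξ
                    (LinearGaussian.D T ξ + LinearGaussian.rowQuartic ξ)) ≤
                  LinearGaussian.avgEntropy P X P' Y T k ∧
                LinearGaussian.avgEntropy P X P' Y T k ≤
                  ENNReal.ofReal (C * LinearGaussian.profile k ξ
                    (LinearGaussian.D T ξ + LinearGaussian.rowQuartic ξ))) ∧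
              (ξ.IsSymm →
                ENNReal.ofReal (c * LinearGaussian.profile k ξ (LinearGaussian.rowQuartic ξ)) ≤
                  LinearGaussian.avgEntropy P X P' Y T k ∧
                LinearGaussian.avgEntropy P X P' Y T k ≤
                  ENNReal.ofReal
                    (C * LinearGaussian.profile k ξ (LinearGaussian.rowQuartic ξ)))) ∧
        -- the bounds on `D_T(ξ)`
        c * ∑ i, (∑ j, ξ i j * ξ j i) ^ 2 ≤ LinearGaussian.D T ξ ∧
        LinearGaussian.D T ξ ≤
          C * (∑ i, (∑ j, ξ i j ^ 2) ^ 2 + ∑ i, (∑ j, ξ j i ^ 2) ^ 2) := by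
  have hT' : (0 : ℝ) < T := hT
  obtain ⟨c₁, hc₁⟩ : ∃ c₁, c₁ = 1 / (4 * (Real.exp (2 * T * ρ) + 1)) := ⟨_, rfl⟩
  obtain ⟨C₁, hC₁⟩ : ∃ C₁, C₁ = 1 / (2 * Real.exp (-(2 * T * ρ))) := ⟨_, rfl⟩
  obtain ⟨K, hK⟩ : ∃ K, K = T * Real.exp (T * ρ) := ⟨_, rfl⟩
  obtain ⟨c₀, hc₀⟩ : ∃ c₀, c₀ = c₁ * min ((T / 2 : ℝ) ^ 2) (min 4 ((T : ℝ) ^ 4 / 9)) := ⟨_, rfl⟩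
  obtain ⟨C₀, hC₀⟩ : ∃ C₀, C₀ = C₁ * (3 * (2 * K ^ 2 + ρ ^ 2 * K ^ 4) + (8 + 2 * K ^ 4)) :=
    ⟨_, rfl⟩
  obtain ⟨L, hL⟩ : ∃ L, L = ((T : ℝ) ^ 2 * Real.exp (T * ρ)) ^ 2 := ⟨_, rfl⟩
  have hc₁0 : 0 < c₁ := by rw [hc₁]; positivity
  have hC₁0 : 0 < C₁ := by rw [hC₁]; positivity
  have hL0 : 0 < L := by rw [hL]; positivity
  have hc₀0 : 0 < c₀ := by rw [hc₀]; positivity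
  have hC₀0 : 0 < C₀ := by rw [hC₀]; positivity
  refine ⟨min c₀ (((T : ℝ) ^ 2 / 6) ^ 2), C₀ * (1 + 2 * L) + L, by positivity, by positivity,
    fun n hn ξ hξ hdiag hρ => ⟨?_, ?_, ?_⟩⟩
  -- the lower constant serves both the entropy bound and the lower bound on `D`; the upper constant
  -- also absorbs `D ≤ 2 L rowQuartic` in the symmetric case and the upper bound on `D`
  · intro _ Ω Ω' _ _ P _ P' _ X Y hX hY k hk hkn
    obtain ⟨hlow, hup⟩ := LinearGaussian.exists_avgEntropy_bounds hT hξ hdiag hρ hX hY hn hk hkn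
      hc₁ hC₁ hK hc₀ hC₀
    have hD := LinearGaussian.D_nonneg T ξ
    have hrow := LinearGaussian.rowQuartic_nonneg ξ
    have hprof := LinearGaussian.profile_nonneg hn hk hkn ξ (add_nonneg hD hrow)
    have hprof' := LinearGaussian.profile_nonneg hn hk hkn ξ hrow
    have hcmin := min_le_left c₀ (((T : ℝ) ^ 2 / 6) ^ 2)
    refine ⟨⟨le_trans (ENNReal.ofReal_le_ofReal ?_) hlow,
      hup.trans (ENNReal.ofReal_le_ofReal ?_)⟩, fun hs =>
      ⟨le_trans (ENNReal.ofReal_le_ofReal ?_) hlow, hup.trans (ENNReal.ofReal_le_ofReal ?_)⟩⟩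
    · gcongr
    · gcongr
      nlinarith [mul_pos hC₀0 hL0]
    · exact mul_le_mul hcmin (LinearGaussian.profile_mono hn hkn ξ (by linarith)) hprof' hc₀0.le
    · have hDle := LinearGaussian.D_le_of_isSymm hξ hdiag hT' hs
      rw [hρ, ← hL] at hDle
      calc C₀ * LinearGaussian.profile k ξ (LinearGaussian.D T ξ + LinearGaussian.rowQuartic ξ)
          ≤ C₀ * LinearGaussian.profile k ξ ((1 + 2 * L) * LinearGaussian.rowQuartic ξ) := by
            refine mul_le_mul_of_nonneg_left ?_ hC₀0.le
            exact LinearGaussian.profile_mono hn hkn ξ (by linarith)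
        _ ≤ C₀ * ((1 + 2 * L) * LinearGaussian.profile k ξ (LinearGaussian.rowQuartic ξ)) :=
            mul_le_mul_of_nonneg_left
              (LinearGaussian.profile_mul_le hn hk ξ (by linarith)) hC₀0.le
        _ ≤ _ := by
            rw [← mul_assoc]
            gcongr
            linarith
  · refine le_trans ?_ (LinearGaussian.le_D hξ hdiag hT')
    gcongr
    exact min_le_right _ _
  · refine (LinearGaussian.D_le hξ hdiag hT').trans ?_
    rw [hρ, ← hL]
    gcongr
    nlinarith [mul_pos hC₀0 hL0]
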